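/- Let $k$ be a field and let $\Delta$ be a simplicial complex on a finite set of vertices $V=\{v_1,\dots,v_n\}$, with facets $F_1,\dots,F_m$ and $\dim\Delta=d-1$. $\Delta$ is strongly connected if any two facets are joined by a sequence of facets in which consecutive ones meet in exactly $d-1$ vertices. A facet $F$ of a complex is a leaf if it is the only facet or there is a facet $G\ne F$ (a branch of $F$) with $H\cap F\subseteq G\cap F$ for all facets $H\neq F$. $\Delta$ is a quasi-forest if its facets have a leaf order, that is, an order $F_1,\dots,F_m$ such that $F_j$ is a leaf of $\langle F_1,\dots,F_j\rangle$ for all $j$; a quasi-tree is a connected quasi-forest. A relation tree $T(\Delta)$ is a graph on the set of facets obtained from a leaf order by choosing, for each $j\ge 2$, a branch $G_j$ of $F_j$ in $\langle F_1,\dots,F_j\rangle$ and taking as edges the pairs $\{F_j,G_j\}$. For a vertex $v_i$, let $T^i(\Delta)$ be the graph obtained from $T(\Delta)$ by merging all facets that contain $v_i$ into one vertex $V_i$; a pair $(F_h,F_l)$ of facets not containing $v_i$ is a directed edge of $(T^i(\Delta),V_i)$ if there is a path $V_i,\dots,F_h,F_l$ in $T^i(\Delta)$. A family $\alpha=(\alpha_i(j))$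 of positive integers, indexed by the pairs $(i,j)$ with $v_i\notin F_j$, is $\Delta$-satisfying if there is a relation tree $T(\Delta)$ such that $\alpha_i(h)\ge\alpha_i(l)$ for all $i$ and all directed edges $(F_h,F_l)$ of $(T^i(\Delta),V_i)$. Put $R=k[x_1,\dots,x_n]$ and $I_{\Delta(\alpha)}=\bigcap_{j=1}^m(x_i^{\alpha_i(j)} : v_i\notin F_j)$. (1) If $\Delta$ is a strongly connected quasi-forest (in particular, if $\Delta$ is a strongly connected quasi-tree) and $\alpha$ is $\Delta$-satisfying, then $R/I_{\Delta(\alpha)}$ is a Cohen–Macaulay ring. (2) The converse fails: for every field $k$ there are a strongly connected quasi-tree $\Delta$ and a family $\alpha$ of positive integers as above such that $R/I_{\Delta(\alpha)}$ is Cohen–Macaulay but $\alpha$ is not $\Delta$-satisfying. -/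

import Mathlib

namespace AbstractSimplicialComplex

variable {V : Type*} (Δ : AbstractSimplicialComplex V)

/-- The facets: the faces that are maximal under inclusion. -/
def facets : Set (Finset V) :=
  {F | Maximal (fun s => s ∈ Δ) F}

/-- The type of facets. -/
abbrev Facet : Type _ := {F : Finset V // F ∈ Δ.facets}

/-- The number `d = dim Δ + 1`, i.e. the maximal cardinality of a face. -/
noncomputable def dimSucc : ℕ :=
  sSup (Finset.card '' {s : Finset V | s ∈ Δ})

section

variable [DecidableEq V]

/-- The facet graph: distinct facets `F`, `G` are adjacent when `|F ∩ G| = d - 1`, where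
`d - 1 = dim Δ`. -/
def facetGraph : SimpleGraph Δ.Facet where
  Adj F G := F ≠ G ∧ (F.1 ∩ G.1).card + 1 = Δ.dimSucc
  symm := ⟨fun F G h => ⟨h.1.symm, by rw [Finset.inter_comm]; exact h.2⟩⟩
  loopless := ⟨fun _ h => h.1 rfl⟩

/-- `Δ` is strongly connected: any two facets are joined by a sequence of facets in which
consecutive ones meet in `d - 1` vertices. -/
def StronglyConnected : Prop :=
  Δ.facetGraph.Preconnected

/-- The graph of vertices and edges (one-dimensional faces) of `Δ`. -/
def oneSkeleton : SimpleGraph V where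
  Adj u v := u ≠ v ∧ ({u, v} : Finset V) ∈ Δ
  symm := ⟨fun u v h => ⟨h.1.symm, by rw [Finset.pair_comm]; exact h.2⟩⟩
  loopless := ⟨fun _ h => h.1 rfl⟩

variable {Δ}

/-- `G` is a branch of `F` in the complex whose set of facets is `S`: `G` is another facet, and
`H ∩ F ⊆ G ∩ F` for every facet `H ≠ F`. -/
def IsBranch (S : Set Δ.Facet) (F G : Δ.Facet) : Prop :=
  G ∈ S ∧ G ≠ F ∧ ∀ H ∈ S, H ≠ F → H.1 ∩ F.1 ⊆ G.1 ∩ F.1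

/-- `F` is a leaf of the complex whose set of facets is `S`: it is the only facet, or it has a
branch. -/
def IsLeaf (S : Set Δ.Facet) (F : Δ.Facet) : Prop :=
  F ∈ S ∧ (S = {F} ∨ ∃ G, IsBranch S F G)

/-- The set of facets `{F₁, …, Fᵢ}` of the complex `⟨F₁, …, Fᵢ⟩`. -/
def initialFacets {m : ℕ} (e : Fin m ≃ Δ.Facet) (i : Fin m) : Set Δ.Facet :=
  {F | ∃ j, j ≤ i ∧ e j = F}

/-- The total order `F₁, …, Fₘ` of the facets of `Δ` is a leaf order: each `Fᵢ` is a leaf of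
`⟨F₁, …, Fᵢ⟩`. -/
def IsLeafOrder {m : ℕ} (e : Fin m ≃ Δ.Facet) : Prop :=
  ∀ i, IsLeaf (initialFacets e i) (e i)

variable (Δ)

/-- A quasi-forest is a simplicial complex that has a leaf order. -/
def IsQuasiForest : Prop :=
  ∃ (m : ℕ) (e : Fin m ≃ Δ.Facet), IsLeafOrder e

/-- A quasi-tree is a connected quasi-forest. -/
def IsQuasiTree : Prop :=
  Δ.IsQuasiForest ∧ Δ.oneSkeleton.Connected

variable {Δ}

/-- `T` is a relation tree of `Δ`: for some leaf order `F₁, …, Fₘ` and some choice, for each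
`i ≥ 2`, of a branch `Gᵢ` of `Fᵢ` in `⟨F₁, …, Fᵢ⟩`, its edges are the pairs `{Fᵢ, Gᵢ}`, `i ≥ 2`
(the first index is `0` below). -/
def IsRelationTree (T : SimpleGraph Δ.Facet) : Prop :=
  ∃ (m : ℕ) (e : Fin m ≃ Δ.Facet) (b : Fin m → Δ.Facet),
    IsLeafOrder e ∧
    (∀ i : Fin m, 0 < i.val → IsBranch (initialFacets e i) (e i) (b i)) ∧
    T = SimpleGraph.fromEdgeSet {x | ∃ i : Fin m, 0 < i.val ∧ x = s(e i, b i)}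

end

variable {Δ}

/-- For a graph `T` on the facets and a vertex `v`, the graph obtained by merging all the facets
that contain `v` into one new vertex `none`. Its other vertices are the facets not containing
`v`. For `T` the facet graph this is the `v`-graph of `Δ`; for `T` a relation tree it is the
corresponding subtree of the `v`-graph. -/
def vertexGraph (T : SimpleGraph Δ.Facet) (v : V) :
    SimpleGraph (Option {F : Δ.Facet // v ∉ F.1}) where
  Adj
    | some F, some G => T.Adj F.1 G.1
    | none, some F => ∃ G : Δ.Facet, v ∈ G.1 ∧ T.Adj G F.1
    | some F, none => ∃ G : Δ.Facet, v ∈ G.1 ∧ T.Adj G F.1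
    | none, none => False
  symm := ⟨by
    rintro (_ | F) (_ | G) h
    · exact h
    · exact h
    · exact h
    · exact SimpleGraph.Adj.symm (G := T) h⟩
  loopless := ⟨by
    rintro (_ | F) h
    · exact h
    · exact T.irrefl h⟩

/-- The pair `(u, w)` is a directed edge of the graph `(T, r)` rooted at `r`: there is a path
`r, …, u, w` in `T`. -/
def IsDirectedEdge {W : Type*} (T : SimpleGraph W) (r u w : W) : Prop :=
  ∃ (p : T.Walk r u) (h : T.Adj u w), (p.concat h).IsPath

/-- The exponents `α v F` (for `v ∉ F`) are `Δ`-satisfying: there is a relation tree `T` such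
that for every vertex `v`, `α v` weakly decreases along the directed edges between facets of the
tree obtained from `T` by merging the facets that contain `v`, rooted at the merged vertex. -/
def Satisfying [DecidableEq V] (α : V → Δ.Facet → ℕ) : Prop :=
  ∃ T : SimpleGraph Δ.Facet, IsRelationTree T ∧
    ∀ (v : V) (F G : {F : Δ.Facet // v ∉ F.1}),
      IsDirectedEdge (vertexGraph T v) none (some F) (some G) → α v G.1 ≤ α v F.1

/-- The ideal `Q_F` generated by the powers `x_v ^ α v F` with `v ∉ F`. -/
noncomputable def primaryComponent (k : Type*) [Field k] (α : V → Δ.Facet → ℕ) (F : Δ.Facet) :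
    Ideal (MvPolynomial V k) :=
  Ideal.span {f | ∃ v : V, v ∉ F.1 ∧ f = MvPolynomial.X v ^ α v F}

/-- The ideal `I_{Δ(α)}`: the intersection of the ideals `Q_F` over all facets `F`. -/
noncomputable def thickenedIdeal (k : Type*) [Field k] (α : V → Δ.Facet → ℕ) :
    Ideal (MvPolynomial V k) :=
  ⨅ F : Δ.Facet, primaryComponent k α F

end AbstractSimplicialComplex

/-- A local ring is Cohen–Macaulay when it is Noetherian and its maximal ideal contains a regular
sequence whose length is the Krull dimension. -/
def IsCohenMacaulayLocalRing (A : Type*) [CommRing A] [IsLocalRing A] : Prop :=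
  IsNoetherianRing A ∧ ∃ rs : List A, (∀ r ∈ rs, r ∈ IsLocalRing.maximalIdeal A) ∧
    RingTheory.Sequence.IsRegular A rs ∧ (rs.length : WithBot ℕ∞) = ringKrullDim A

/-- A ring is Cohen–Macaulay when it is Noetherian and its localizations at maximal ideals are
Cohen–Macaulay local rings. -/
def IsCohenMacaulayRing (A : Type*) [CommRing A] : Prop :=
  IsNoetherianRing A ∧ ∀ (m : Ideal A) [m.IsMaximal],
    IsCohenMacaulayLocalRing (Localization.AtPrime m)

/-! Strong connectedness and the leaf order give a colouring of the vertices by `d` colours in which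
every facet has each colour exactly once (`StronglyConnected.exists_colouring`). For a maximal ideal
`m`, let `y c ∈ m` be a monic polynomial in the sum of the variables of colour `c`. Every prime
containing the ideal and all `y c` is maximal, so Cohen–Macaulayness follows once the `y c` form a
weakly regular sequence on the quotient (`isCohenMacaulayRing_of_regularOn`).

Regularity is proved by adding components along the leaf order. Let `J` be the intersection of the
earlier components, `F` the new facet and `G` its branch. In `0 → R/(J ∩ Q_F) → R/J × R/Q_F → R/(J +
Q_F) → 0` the right-hand term only has to be regular for all colours but one
(`RegularOn.quotient_inf`). The inequalities on the exponents give `J + Q_F = Q_G + Q_F`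
(`exponent_dichotomy`, `regularOn_inf_primaryComponent`). This ideal omits the variables of `F ∩ G`,
which carry `d - 1` colours, and `y c` is monic in each variable of colour `c`.

For the failure of the converse, take three edges at a common vertex: all sums of components omit
that vertex's variable, so the same depth count works whatever the exponents are, while a cyclic
pattern of exponents violates the condition for every relation tree.

Sequences are required to be regular in every order because the rings are not local, where permuting
a regular sequence can fail. -/

open RingTheory.Sequence Pointwise

/-! ### Depth lemmas for sequences that are regular in every order. -/

section RegularSequences

variable {R : Type*} [CommRing R] {κ : Type*}

/-- Every sequence of distinct elements `y c`, `c ∈ C`, is weakly regular on `M`. -/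
def RegularOn (y : κ → R) (C : Set κ) (M : Type*) [AddCommGroup M] [Module R M] : Prop :=
  ∀ l : List κ, l.Nodup → (∀ c ∈ l, c ∈ C) → IsWeaklyRegular M (l.map y)

variable {N M L : Type*} [AddCommGroup N] [Module R N] [AddCommGroup M] [Module R M]
  [AddCommGroup L] [Module R L] {y : κ → R} {C : Set κ}

theorem RegularOn.mono (h : RegularOn y C M) {D : Set κ} (hD : D ⊆ C) : RegularOn y D M :=
  fun l hl hlD => h l hl fun c hc => hD (hlD c hc)

theorem RegularOn.isSMulRegular (h : RegularOn y C M) {c : κ} (hc : c ∈ C) :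
    IsSMulRegular M (y c) := by
  have := h [c] (by simp) (by simpa using hc)
  simpa using this

theorem RegularOn.quotSMulTop (h : RegularOn y C M) {c : κ} (hc : c ∈ C) :
    RegularOn y (C \ {c}) (QuotSMulTop (y c) M) := by
  intro l hl hlC
  have := h (c :: l) (List.nodup_cons.2 ⟨fun hcl => (hlC c hcl).2 rfl, hl⟩)
    (by simpa [hc] using fun a ha => (hlC a ha).1)
  rw [List.map_cons, isWeaklyRegular_cons_iff] at this
  exact this.2

theorem RegularOn.congr (e : M ≃ₗ[R] N) (h : RegularOn y C M) : RegularOn y C N :=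
  fun l hl hlC => (e.isWeaklyRegular_congr _).1 (h l hl hlC)

theorem RegularOn.of_subsingleton [Subsingleton M] : RegularOn y C M := by
  intro l _ _
  rw [isWeaklyRegular_iff]
  intro i hi a b _
  obtain ⟨a, rfl⟩ := Submodule.Quotient.mk_surjective _ a
  obtain ⟨b, rfl⟩ := Submodule.Quotient.mk_surjective _ b
  rw [Subsingleton.elim a b]

/-- If `r • m` comes from `N`, then `r` kills `g m`, so `m` itself comes from `N`. Hence a short
exact sequence stays exact modulo an `L`-regular element. -/
theorem QuotSMulTop.map_injective_of_exact {f : N →ₗ[R] M} {g : M →ₗ[R] L} {r : R}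
    (hf : Function.Injective f) (hfg : Function.Exact f g) (hr : IsSMulRegular L r) :
    Function.Injective (QuotSMulTop.map r f) := by
  rw [injective_iff_map_eq_zero]
  intro x
  obtain ⟨n, rfl⟩ := Submodule.Quotient.mk_surjective _ x
  intro hx
  change Submodule.Quotient.mk (f n) = 0 at hx
  rw [Submodule.Quotient.mk_eq_zero, Submodule.mem_smul_pointwise_iff_exists] at hx ⊢
  obtain ⟨m, -, hm⟩ := hx
  have hgm : g m = 0 := hr (by
    change r • g m = r • 0
    rw [← map_smul, hm, smul_zero]
    exact hfg.apply_apply_eq_zero n)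
  obtain ⟨n', rfl⟩ := (hfg m).1 hgm
  exact ⟨n', trivial, hf (by rw [map_smul, hm])⟩

theorem IsSMulRegular.quotSMulTop_swap {a b : R} (ha : IsSMulRegular M a)
    (hab : IsSMulRegular (QuotSMulTop a M) b) :
    IsSMulRegular (QuotSMulTop b M) a := by
  have key : ∀ m : M, b • m ∈ a • (⊤ : Submodule R M) → m ∈ a • (⊤ : Submodule R M) := by
    intro m hm
    rw [← Submodule.Quotient.mk_eq_zero] at hm ⊢
    exact hab (by simpa using hm)
  apply IsSMulRegular.of_right_eq_zero_of_smul
  intro x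
  obtain ⟨m, rfl⟩ := Submodule.Quotient.mk_surjective _ x
  intro hx
  rw [← Submodule.Quotient.mk_smul, Submodule.Quotient.mk_eq_zero,
    Submodule.mem_smul_pointwise_iff_exists] at hx
  rw [Submodule.Quotient.mk_eq_zero, Submodule.mem_smul_pointwise_iff_exists]
  obtain ⟨n, -, hn⟩ := hx
  have := key n (by rw [hn]; exact Submodule.smul_mem_pointwise_smul _ _ _ trivial)
  rw [Submodule.mem_smul_pointwise_iff_exists] at this
  obtain ⟨p, -, rfl⟩ := this
  refine ⟨p, trivial, ha ?_⟩
  change a • b • p = a • m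
  rw [← hn, smul_comm]

theorem RingTheory.Sequence.IsWeaklyRegular.swap_head {a b : R} {rs : List R}
    (h : IsWeaklyRegular M (a :: b :: rs)) (hb : IsSMulRegular M b) :
    IsWeaklyRegular M (b :: a :: rs) := by
  have h1 : a :: b :: rs = [a, b] ++ rs := rfl
  have h2 : b :: a :: rs = [b, a] ++ rs := rfl
  rw [h1, isWeaklyRegular_append_iff] at h
  rw [h2, isWeaklyRegular_append_iff]
  have e : Ideal.ofList [b, a] = Ideal.ofList [a, b] :=
    congrArg Ideal.span <| Set.ext fun _ => (List.Perm.swap a b []).mem_iff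
  refine ⟨?_, ?_⟩
  · have h3 := h.1
    simp only [isWeaklyRegular_cons_iff, IsWeaklyRegular.nil, and_true] at h3 ⊢
    exact ⟨hb, h3.1.quotSMulTop_swap h3.2⟩
  · rw [(Submodule.quotEquivOfEq _ _ (congrArg₂ _ e rfl)).isWeaklyRegular_congr]
    exact h.2

/-- The exceptional index `c` is pushed to the end: each following `r` is swapped in front of it and
divided out, which keeps the sequence exact. When only `c` is left, regularity on `M` passes to the
submodule `N`, so `y c` is never tested on `L`. -/
theorem RegularOn.isWeaklyRegular_cons_of_exact {t : List κ} {f : N →ₗ[R] M} {g : M →ₗ[R] L}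
    {c : κ} (hf : Function.Injective f) (hfg : Function.Exact f g)
    (hg : Function.Surjective g) (hM : RegularOn y C M) (hL : RegularOn y (C \ {c}) L)
    (hct : (c :: t).Nodup) (hC : ∀ a ∈ c :: t, a ∈ C) :
    IsWeaklyRegular N ((c :: t).map y) := by
  induction t generalizing C N M L with
  | nil =>
    simp only [List.map_cons, List.map_nil, isWeaklyRegular_cons_iff, IsWeaklyRegular.nil,
      and_true]
    exact (hM.isSMulRegular (hC c (by simp))).of_injective f hf
  | cons r t ih =>
    have hcr : c ≠ r := fun h => by simp [h] at hct
    have hc : c ∈ C := hC c (by simp)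
    have hr : r ∈ C := hC r (by simp)
    have hLr := hL.isSMulRegular (c := r) ⟨hr, hcr.symm⟩
    refine IsWeaklyRegular.swap_head ?_ ((hM.isSMulRegular hc).of_injective f hf)
    rw [isWeaklyRegular_cons_iff]
    refine ⟨(hM.isSMulRegular hr).of_injective f hf, ?_⟩
    refine ih (C := C \ {r}) (QuotSMulTop.map_injective_of_exact hf hfg hLr)
      (QuotSMulTop.map_exact _ hfg hg) (QuotSMulTop.map_surjective _ hg)
      (hM.quotSMulTop hr) ?_ ?_ ?_
    · refine (hL.quotSMulTop (c := r) ⟨hr, hcr.symm⟩).mono ?_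
      rintro a ⟨⟨h1, h2⟩, h3⟩
      exact ⟨⟨h1, h3⟩, h2⟩
    · simp only [List.nodup_cons, List.mem_cons, not_or] at hct ⊢
      exact ⟨hct.1.2, hct.2.2⟩
    · intro a ha
      refine ⟨hC a ?_, ?_⟩
      · simp only [List.mem_cons] at ha ⊢
        tauto
      · rintro rfl
        simp only [List.nodup_cons, List.mem_cons] at hct ha
        rcases ha with rfl | ha
        · exact hcr rfl
        · exact hct.2.1 ha

/-- The depth lemma: if `0 → N → M → L → 0` is exact and the depth of `L` is at least the depth
of `M` minus one, then the depth of `N` is at least the depth of `M`. -/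
theorem RegularOn.of_exact {f : N →ₗ[R] M} {g : M →ₗ[R] L} {c : κ} (hf : Function.Injective f)
    (hfg : Function.Exact f g) (hg : Function.Surjective g) (hM : RegularOn y C M)
    (hL : RegularOn y (C \ {c}) L) : RegularOn y C N := by
  intro l hl hlC
  induction l generalizing C N M L with
  | nil => simp
  | cons r t ih =>
    -- Any other index is divided out of all three modules; once `c` heads the list, the preceding
    -- lemma applies.
    by_cases hcr : r = c
    · subst hcr
      exact RegularOn.isWeaklyRegular_cons_of_exact hf hfg hg hM hL hl hlC
    have hr : r ∈ C := hlC r (by simp)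
    have hLr := hL.isSMulRegular (c := r) ⟨hr, hcr⟩
    rw [List.map_cons, isWeaklyRegular_cons_iff]
    refine ⟨(hM.isSMulRegular hr).of_injective f hf, ?_⟩
    rw [List.nodup_cons] at hl
    refine ih (C := C \ {r}) (QuotSMulTop.map_injective_of_exact hf hfg hLr)
      (QuotSMulTop.map_exact _ hfg hg) (QuotSMulTop.map_surjective _ hg)
      (hM.quotSMulTop hr) ?_ hl.2 ?_
    · refine (hL.quotSMulTop (c := r) ⟨hr, hcr⟩).mono ?_
      rintro a ⟨⟨h1, h2⟩, h3⟩
      exact ⟨⟨h1, h3⟩, h2⟩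
    · intro a ha
      refine ⟨hlC a (by simp [ha]), ?_⟩
      rintro rfl
      exact hl.1 ha

theorem IsSMulRegular.of_exact {f : N →ₗ[R] M} {g : M →ₗ[R] L} {r : R}
    (hf : Function.Injective f) (hfg : Function.Exact f g) (hN : IsSMulRegular N r)
    (hL : IsSMulRegular L r) : IsSMulRegular M r :=
  isSMulRegular_of_range_eq_ker hf hfg.linearMap_ker_eq.symm hN hL

theorem RegularOn.extension {f : N →ₗ[R] M} {g : M →ₗ[R] L} (hf : Function.Injective f)
    (hfg : Function.Exact f g) (hg : Function.Surjective g) (hN : RegularOn y C N)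
    (hL : RegularOn y C L) : RegularOn y C M := by
  intro l hl hlC
  induction l generalizing C N M L with
  | nil => simp
  | cons r t ih =>
    have hr : r ∈ C := hlC r (by simp)
    rw [List.map_cons, isWeaklyRegular_cons_iff]
    refine ⟨.of_exact hf hfg (hN.isSMulRegular hr) (hL.isSMulRegular hr), ?_⟩
    rw [List.nodup_cons] at hl
    refine ih (C := C \ {r})
      (QuotSMulTop.map_injective_of_exact hf hfg (hL.isSMulRegular hr))
      (QuotSMulTop.map_exact _ hfg hg) (QuotSMulTop.map_surjective _ hg)
      (hN.quotSMulTop hr) (hL.quotSMulTop hr) hl.2 fun a ha => ⟨hlC a (by simp [ha]), ?_⟩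
    rintro rfl
    exact hl.1 ha

theorem RegularOn.prod (hN : RegularOn y C N) (hM : RegularOn y C M) : RegularOn y C (N × M) :=
  RegularOn.extension (f := LinearMap.inl R N M) (g := LinearMap.snd R N M)
    LinearMap.inl_injective Function.Exact.inl_snd LinearMap.snd_surjective hN hM

/-- The depth lemma for the Mayer–Vietoris sequence of two ideals. -/
theorem RegularOn.quotient_inf {I J : Ideal R} {c : κ} (hI : RegularOn y C (R ⧸ I))
    (hJ : RegularOn y C (R ⧸ J)) (hIJ : RegularOn y (C \ {c}) (R ⧸ (I ⊔ J))) :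
    RegularOn y C (R ⧸ (I ⊓ J)) := by
  let f : (R ⧸ (I ⊓ J)) →ₗ[R] (R ⧸ I) × (R ⧸ J) :=
    (Submodule.factor inf_le_left).prod (Submodule.factor inf_le_right)
  let g : (R ⧸ I) × (R ⧸ J) →ₗ[R] (R ⧸ (I ⊔ J)) :=
    (Submodule.factor le_sup_left).coprod (-Submodule.factor le_sup_right)
  refine RegularOn.of_exact (f := f) (g := g) ?_ ?_ ?_ (hI.prod hJ) hIJ
  · rw [injective_iff_map_eq_zero]
    intro x
    obtain ⟨x, rfl⟩ := Submodule.Quotient.mk_surjective _ x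
    intro hx
    have h1 : (Submodule.Quotient.mk x : R ⧸ I) = 0 := congrArg Prod.fst hx
    have h2 : (Submodule.Quotient.mk x : R ⧸ J) = 0 := congrArg Prod.snd hx
    rw [Submodule.Quotient.mk_eq_zero] at h1 h2 ⊢
    exact ⟨h1, h2⟩
  · rintro ⟨a, b⟩
    obtain ⟨a, rfl⟩ := Submodule.Quotient.mk_surjective _ a
    obtain ⟨b, rfl⟩ := Submodule.Quotient.mk_surjective _ b
    have hg : g (Submodule.Quotient.mk a, Submodule.Quotient.mk b) =
        Submodule.Quotient.mk (a - b) := by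
      simp [g, sub_eq_add_neg]
    rw [hg, Submodule.Quotient.mk_eq_zero]
    constructor
    · intro h
      obtain ⟨i, hi, j, hj, hij⟩ := Submodule.mem_sup.1 h
      refine ⟨Submodule.Quotient.mk (a - i), Prod.ext ?_ ?_⟩
      · change (Submodule.Quotient.mk (a - i) : R ⧸ I) = Submodule.Quotient.mk a
        rw [Submodule.Quotient.eq]
        simpa using hi
      · change (Submodule.Quotient.mk (a - i) : R ⧸ J) = Submodule.Quotient.mk b
        rw [Submodule.Quotient.eq]
        have : a - i - b = j := by linear_combination -hij
        rwa [this]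
    · rintro ⟨x, hx⟩
      obtain ⟨x, rfl⟩ := Submodule.Quotient.mk_surjective _ x
      have h1 : (Submodule.Quotient.mk x : R ⧸ I) = Submodule.Quotient.mk a :=
        congrArg Prod.fst hx
      have h2 : (Submodule.Quotient.mk x : R ⧸ J) = Submodule.Quotient.mk b :=
        congrArg Prod.snd hx
      rw [Submodule.Quotient.eq] at h1 h2
      refine Submodule.mem_sup.2 ⟨-(x - a), neg_mem h1, x - b, h2, by ring⟩
  · intro x
    obtain ⟨x, rfl⟩ := Submodule.Quotient.mk_surjective _ x
    exact ⟨(Submodule.Quotient.mk x, 0), by simp [g]⟩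

/-- `P` is an invariant of the pair (current ideal, indices not yet used), preserved when one more
element is added to the ideal. -/
theorem RegularOn.quotient_of_regular_step (P : Ideal R → Set κ → Prop)
    (hP : ∀ J D c, P J D → c ∈ D →
      (∀ f, y c * f ∈ J → f ∈ J) ∧ P (J ⊔ Ideal.span {y c}) (D \ {c}))
    {J : Ideal R} (hJ : P J C) : RegularOn y C (R ⧸ J) := by
  intro l hl hlC
  induction l generalizing J C with
  | nil => simp
  | cons r t ih =>
    obtain ⟨h1, h2⟩ := hP J C r hJ (hlC r (by simp))
    rw [List.map_cons, isWeaklyRegular_cons_iff]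
    rw [List.nodup_cons] at hl
    refine ⟨?_, ?_⟩
    · apply IsSMulRegular.of_right_eq_zero_of_smul
      intro x
      obtain ⟨x, rfl⟩ := Submodule.Quotient.mk_surjective _ x
      rw [← Submodule.Quotient.mk_smul, Submodule.Quotient.mk_eq_zero,
        Submodule.Quotient.mk_eq_zero]
      exact h1 x
    · have := ih h2 hl.2 fun a ha => ⟨hlC a (by simp [ha]), by rintro rfl; exact hl.1 ha⟩
      refine (LinearEquiv.isWeaklyRegular_congr ?_ _).1 this
      refine (Submodule.quotientQuotientEquivQuotientSup J (Ideal.span {y r})).symm ≪≫ₗ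
        Submodule.quotEquivOfEq _ _ ?_
      have : (Ideal.span {y r} : Ideal R) = y r • (⊤ : Submodule R R) := by
        rw [← Submodule.ideal_span_singleton_smul, smul_eq_mul, Ideal.mul_top]
      rw [this, Submodule.map_pointwise_smul, Submodule.map_top, Submodule.range_mkQ]

end RegularSequences

/-! ### Ideals that do not involve a given variable. -/

namespace MvPolynomial

variable {k V : Type*} [Field k] [DecidableEq V]

/-- Polynomials in the variables `V` as univariate polynomials in the variable `v`. -/
noncomputable def isolate (k : Type*) [Field k] (v : V) :
    MvPolynomial V k ≃ₐ[k] Polynomial (MvPolynomial {u // u ≠ v} k) :=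
  (renameEquiv k (Equiv.optionSubtypeNe v).symm).trans (optionEquivLeft k _)

theorem isolate_X_self (v : V) : isolate k v (X v) = Polynomial.X := by
  simp [isolate]

theorem isolate_X_of_ne {u v : V} (h : u ≠ v) :
    isolate k v (X u) = Polynomial.C (X ⟨u, h⟩) := by
  simp [isolate, Equiv.optionSubtypeNe_symm_of_ne h]

/-- The polynomials in which the variable `v` does not occur. -/
noncomputable def withoutVar (k : Type*) [Field k] (v : V) : Subalgebra k (MvPolynomial V k) :=
  (Algebra.ofId _ _ : MvPolynomial {u // u ≠ v} k →ₐ[MvPolynomial {u // u ≠ v} k]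
    Polynomial (MvPolynomial {u // u ≠ v} k)).restrictScalars k |>.range.comap
      (isolate k v).toAlgHom

theorem mem_withoutVar {v : V} {f : MvPolynomial V k} :
    f ∈ withoutVar k v ↔ ∃ g, isolate k v f = Polynomial.C g := by
  simp only [withoutVar, Subalgebra.mem_comap, AlgHom.mem_range]
  exact exists_congr fun g => eq_comm

theorem X_mem_withoutVar {u v : V} (h : u ≠ v) : (X u : MvPolynomial V k) ∈ withoutVar k v :=
  mem_withoutVar.2 ⟨_, isolate_X_of_ne h⟩

end MvPolynomial

open MvPolynomial

/-- The ideal `J` is extended from the polynomial ring in the variables other than `v`. -/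
def Ideal.IndependentOf {k V : Type*} [Field k] [DecidableEq V] (J : Ideal (MvPolynomial V k))
    (v : V) : Prop :=
  ∃ J' : Ideal (MvPolynomial {u // u ≠ v} k), ∀ f, f ∈ J ↔ ∀ n, (isolate k v f).coeff n ∈ J'

namespace Ideal.IndependentOf

variable {k V : Type*} [Field k] [DecidableEq V] {I J : Ideal (MvPolynomial V k)} {v : V}

theorem iff_exists_comap : J.IndependentOf v ↔ ∃ J' : Ideal (MvPolynomial {u // u ≠ v} k),
    J = (J'.map Polynomial.C).comap (isolate k v).toRingEquiv.toRingHom := by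
  refine exists_congr fun J' => ?_
  rw [SetLike.ext_iff]
  refine forall_congr' fun f => ?_
  rw [Ideal.mem_comap, Ideal.mem_map_C_iff]
  rfl

theorem inf (hI : I.IndependentOf v) (hJ : J.IndependentOf v) : (I ⊓ J).IndependentOf v := by
  obtain ⟨I', hI'⟩ := hI
  obtain ⟨J', hJ'⟩ := hJ
  refine ⟨I' ⊓ J', fun f => ?_⟩
  simp only [Submodule.mem_inf, hI', hJ', forall_and]

theorem iff_exists_map : J.IndependentOf v ↔ ∃ J' : Ideal (MvPolynomial {u // u ≠ v} k),
    J = (J'.map Polynomial.C).map (isolate k v).symm.toRingEquiv.toRingHom := by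
  rw [iff_exists_comap]
  refine exists_congr fun J' => ?_
  have : (J'.map Polynomial.C).map (isolate k v).symm.toRingEquiv.toRingHom =
      (J'.map Polynomial.C).comap (isolate k v).toRingEquiv.toRingHom :=
    Ideal.map_symm (I := J'.map Polynomial.C) (isolate k v).toRingEquiv
  rw [this]

theorem sup (hI : I.IndependentOf v) (hJ : J.IndependentOf v) : (I ⊔ J).IndependentOf v := by
  rw [iff_exists_map] at *
  obtain ⟨I', rfl⟩ := hI
  obtain ⟨J', rfl⟩ := hJ
  exact ⟨I' ⊔ J', by simp only [Ideal.map_sup]⟩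

theorem span {S : Set (MvPolynomial V k)} (hS : ∀ f ∈ S, f ∈ withoutVar k v) :
    (Ideal.span S).IndependentOf v := by
  rw [iff_exists_map]
  refine ⟨Ideal.span {g | (isolate k v).symm (Polynomial.C g) ∈ S}, ?_⟩
  rw [Ideal.map_span, Ideal.map_span]
  congr 1
  ext f
  constructor
  · intro hf
    obtain ⟨g, hg⟩ := mem_withoutVar.1 (hS f hf)
    have : (isolate k v).symm (Polynomial.C g) = f := by rw [← hg]; simp
    exact ⟨Polynomial.C g, ⟨g, by simpa [this] using hf, rfl⟩, this⟩
  · rintro ⟨_, ⟨g, hg, rfl⟩, rfl⟩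
    exact hg

/-- The quotient by `J` is a polynomial ring in `v` over the quotient by `J'`, and monic polynomials
are not zero divisors there. -/
theorem mem_of_mul_mem (hJ : J.IndependentOf v) {p f : MvPolynomial V k}
    (hp : (isolate k v p).Monic) (h : p * f ∈ J) : f ∈ J := by
  obtain ⟨J', hJ⟩ := hJ
  have key : ∀ f, f ∈ J ↔ (isolate k v f).map (Ideal.Quotient.mk J') = 0 := by
    intro f
    rw [hJ, Polynomial.ext_iff]
    simp [Ideal.Quotient.eq_zero_iff_mem]
  rw [key] at h ⊢
  rw [map_mul, Polynomial.map_mul] at h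
  exact ((hp.map _).mul_right_eq_zero_iff).1 h

end Ideal.IndependentOf

/-! ### Parameters attached to a vertex colouring. -/

section ColourSums

variable {k V κ : Type*} [Field k] [Fintype V] [DecidableEq V] [DecidableEq κ]

/-- The polynomial `q c` evaluated at the sum of the variables of colour `c`. -/
noncomputable def colourParameter (χ : V → κ) (q : κ → Polynomial k) (c : κ) :
    MvPolynomial V k :=
  Polynomial.aeval (∑ v with χ v = c, X v) (q c)

theorem colourParameter_mem_withoutVar (χ : V → κ) (q : κ → Polynomial k) {c : κ} {v : V}
    (h : χ v ≠ c) : colourParameter χ q c ∈ withoutVar k v := by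
  have h1 : ∑ u with χ u = c, (X u : MvPolynomial V k) ∈ withoutVar k v := by
    refine Subalgebra.sum_mem _ fun u hu => X_mem_withoutVar ?_
    rintro rfl
    exact h (Finset.mem_filter.1 hu).2
  exact (Algebra.adjoin_le (by simpa using h1) : _ ≤ withoutVar k v)
    (Polynomial.aeval_mem_adjoin_singleton k _)

/-- As a polynomial in `v` the colour sum is `v + g` with `g` free of `v`, and substituting `X + g`
keeps `q` monic. -/
theorem monic_isolate_colourParameter (χ : V → κ) {q : κ → Polynomial k} {v : V}
    (hq : (q (χ v)).Monic) : (isolate k v (colourParameter χ q (χ v))).Monic := by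
  have h1 : ∑ u ∈ {u | χ u = χ v}, (X u : MvPolynomial V k) =
      X v + ∑ u ∈ ({u | χ u = χ v} : Finset V).erase v, X u :=
    (Finset.add_sum_erase _ _ (by simp)).symm
  have h2 : ∑ u ∈ ({u | χ u = χ v} : Finset V).erase v, (X u : MvPolynomial V k) ∈
      withoutVar k v :=
    Subalgebra.sum_mem _ fun u hu => X_mem_withoutVar (Finset.ne_of_mem_erase hu)
  obtain ⟨g, hg⟩ := mem_withoutVar.1 h2
  have h3 : isolate k v (colourParameter χ q (χ v)) =
      ((q (χ v)).map (algebraMap k (MvPolynomial {u // u ≠ v} k))).comp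
        (Polynomial.X + Polynomial.C g) := by
    rw [colourParameter, h1, ← Polynomial.aeval_algHom_apply, map_add, isolate_X_self, hg,
      Polynomial.comp, Polynomial.eval₂_map, Polynomial.aeval_def]
    rfl
  rw [h3]
  exact (hq.map _).comp_X_add_C _

/-- If `J` does not involve the variables in `U`, the parameters of the colours of `U` form a
weakly regular sequence modulo `J`. -/
theorem RegularOn.quotient_of_independentOf (χ : V → κ) {q : κ → Polynomial k}
    (hq : ∀ c, (q c).Monic) {U : Set V} {J : Ideal (MvPolynomial V k)}
    (hJ : ∀ v ∈ U, J.IndependentOf v) {C : Set κ} (hC : C ⊆ χ '' U) :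
    RegularOn (colourParameter χ q) C (MvPolynomial V k ⧸ J) := by
  -- Invariant: each unused colour has a variable in `U` of which the current ideal is free. Adding
  -- `y c` preserves this, since `y c` only involves variables of colour `c`.
  refine RegularOn.quotient_of_regular_step
    (fun J C => ∀ c ∈ C, ∃ v ∈ U, χ v = c ∧ J.IndependentOf v) ?_ ?_
  · intro J D c hJ hc
    refine ⟨?_, ?_⟩
    · obtain ⟨v, hv, rfl, hvJ⟩ := hJ c hc
      exact fun f => hvJ.mem_of_mul_mem (monic_isolate_colourParameter χ (hq _))
    · rintro a ⟨ha, hac⟩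
      obtain ⟨v, hv, rfl, hvJ⟩ := hJ a ha
      refine ⟨v, hv, rfl, hvJ.sup (.span ?_)⟩
      rintro _ rfl
      exact colourParameter_mem_withoutVar χ q hac
  · intro c hc
    obtain ⟨v, hv, rfl⟩ := hC hc
    exact ⟨v, hv, rfl, hJ v hv⟩

end ColourSums

/-! ### From regular sequences of parameters to Cohen–Macaulay rings. -/

theorem IsCohenMacaulayRing.of_forall_exists_isWeaklyRegular {B : Type*} [CommRing B]
    [IsNoetherianRing B]
    (h : ∀ m : Ideal B, m.IsMaximal → ∃ rs : List B, (∀ r ∈ rs, r ∈ m) ∧ IsWeaklyRegular B rs ∧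
      ∀ p : Ideal B, p.IsPrime → (∀ r ∈ rs, r ∈ p) → p.IsMaximal) :
    IsCohenMacaulayRing B := by
  refine ⟨inferInstance, fun m hm => ⟨IsLocalization.isNoetherianRing m.primeCompl _ ‹_›, ?_⟩⟩
  obtain ⟨rs, hrm, hrs, hmax⟩ := h m hm
  let A := Localization.AtPrime m
  have hreg := hrs.isRegular_of_isLocalization_of_mem A m hrm
  have hmem : ∀ r ∈ rs.map (algebraMap B A), r ∈ IsLocalRing.maximalIdeal A := by
    intro r hr
    obtain ⟨b, hb, rfl⟩ := List.mem_map.1 hr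
    exact (IsLocalization.AtPrime.to_map_mem_maximal_iff A m b).2 (hrm b hb)
  have : IsNoetherianRing A := IsLocalization.isNoetherianRing m.primeCompl _ ‹_›
  refine ⟨rs.map (algebraMap B A), hmem, hreg, ?_⟩
  -- It remains to see that the quotient by the sequence has dimension zero: its primes pull back to
  -- primes of `B` containing `rs`, which are maximal and lie in `m`.
  rw [← ringKrullDim_add_length_eq_ringKrullDim_of_isRegular _ hreg]
  have hle : Ideal.ofList (rs.map (algebraMap B A)) ≤ IsLocalRing.maximalIdeal A :=
    Ideal.span_le.2 hmem
  have : Nontrivial (A ⧸ Ideal.ofList (rs.map (algebraMap B A))) :=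
    Ideal.Quotient.nontrivial_iff.2 fun htop =>
      Ideal.IsPrime.ne_top' (I := IsLocalRing.maximalIdeal A) (top_le_iff.1 (htop ▸ hle))
  have hdim : Ring.KrullDimLE 0 (A ⧸ Ideal.ofList (rs.map (algebraMap B A))) := by
    rw [Ideal.krullDimLE_zero_quotient_iff_forall_minimalPrimes_isMaximal]
    intro P hP
    have hPprime : P.IsPrime := hP.1.1
    have hPle : Ideal.ofList (rs.map (algebraMap B A)) ≤ P := hP.1.2
    have hcm : (P.comap (algebraMap B A)).IsMaximal := by
      refine hmax _ inferInstance fun r hr => ?_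
      exact hPle (Ideal.subset_span (List.mem_map.2 ⟨r, hr, rfl⟩))
    have hcle : P.comap (algebraMap B A) ≤ m := by
      intro b hb
      rw [← IsLocalization.AtPrime.to_map_mem_maximal_iff A m b]
      exact IsLocalRing.le_maximalIdeal hPprime.ne_top hb
    have heq : P.comap (algebraMap B A) = m := hcm.eq_of_le hm.ne_top hcle
    have : P = IsLocalRing.maximalIdeal A := by
      rw [← IsLocalization.map_under m.primeCompl A P, Ideal.under, heq]
      exact Localization.AtPrime.map_eq_maximalIdeal
    rw [this]
    infer_instance
  rw [ringKrullDimZero_iff_ringKrullDim_eq_zero.1 hdim, zero_add]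

/-- By the Nullstellensatz the residue field is finite over `k`. This supplies parameters at every
maximal ideal, not only at the origin and without assuming `k` algebraically closed. -/
theorem MvPolynomial.exists_monic_aeval_mem {k V : Type*} [Field k] [Finite V]
    (m : Ideal (MvPolynomial V k)) [m.IsMaximal] (f : MvPolynomial V k) :
    ∃ q : Polynomial k, q.Monic ∧ Polynomial.aeval f q ∈ m := by
  let _ := Ideal.Quotient.field m
  have : Module.Finite k (MvPolynomial V k ⧸ m) := finite_of_finite_type_of_isJacobsonRing k _
  obtain ⟨q, hq, h⟩ := Algebra.IsIntegral.isIntegral (R := k) (Ideal.Quotient.mk m f)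
  refine ⟨q, hq, ?_⟩
  rw [← Ideal.Quotient.eq_zero_iff_mem]
  have : Ideal.Quotient.mk m (Polynomial.aeval f q) =
      Polynomial.aeval (Ideal.Quotient.mk m f) q :=
    (Polynomial.aeval_algHom_apply (Ideal.Quotient.mkₐ k m) f q).symm
  rw [this]
  exact h

namespace AbstractSimplicialComplex

variable {k V κ : Type*} [Field k] [Fintype V] [DecidableEq V] [DecidableEq κ]
  {Δ : AbstractSimplicialComplex V}

omit [DecidableEq V] in
instance : Finite Δ.Facet := Subtype.finite

/-- The prime `P` contains some `Q_F`, hence every variable outside `F`. Modulo `P` a colour sum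
therefore reduces to the single variable of `F` of that colour, if there is one, and `y c ∈ P` makes
it integral over `k`. A domain integral over a field is a field. -/
theorem isMaximal_of_colourParameter_mem {χ : V → κ} (hχ : ∀ F : Δ.Facet, Set.InjOn χ F.1)
    {α : V → Δ.Facet → ℕ} {q : κ → Polynomial k} (hq : ∀ c, (q c).Monic)
    {P : Ideal (MvPolynomial V k)} [P.IsPrime] (hP : thickenedIdeal k α ≤ P)
    (hy : ∀ c, colourParameter χ q c ∈ P) : P.IsMaximal := by
  have hF : ∃ F : Δ.Facet, primaryComponent k α F ≤ P := by
    have := Fintype.ofFinite Δ.Facet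
    have h := (Ideal.IsPrime.inf_le' (s := Finset.univ) (f := primaryComponent k α) ‹_›).1
      (by rwa [Finset.inf_univ_eq_iInf])
    simpa using h
  obtain ⟨F, hF⟩ := hF
  have hX : ∀ v, v ∉ F.1 → (X v : MvPolynomial V k) ∈ P := fun v hv =>
    Ideal.IsPrime.mem_of_pow_mem ‹_› (α v F) (hF (Ideal.subset_span ⟨v, hv, rfl⟩))
  have hint : ∀ v, IsIntegral k (Ideal.Quotient.mk P (X v)) := by
    intro v
    by_cases hv : v ∈ F.1
    · refine ⟨q (χ v), hq _, ?_⟩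
      have hsum : Ideal.Quotient.mk P (∑ u with χ u = χ v, X u) = Ideal.Quotient.mk P (X v) := by
        rw [map_sum, Finset.sum_eq_single v]
        · intro u hu huv
          rw [Ideal.Quotient.eq_zero_iff_mem]
          exact hX u fun huF => huv (hχ F huF hv (Finset.mem_filter.1 hu).2)
        · simp
      have h := Polynomial.aeval_algHom_apply (Ideal.Quotient.mkₐ k P)
        (∑ u with χ u = χ v, X u) (q (χ v))
      rw [Ideal.Quotient.mkₐ_eq_mk, hsum] at h
      have h0 : Ideal.Quotient.mk P (colourParameter χ q (χ v)) = 0 :=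
        Ideal.Quotient.eq_zero_iff_mem.2 (hy _)
      exact h.trans h0
    · rw [Ideal.Quotient.eq_zero_iff_mem.2 (hX v hv)]
      exact isIntegral_zero
  have hall : Algebra.IsIntegral k (MvPolynomial V k ⧸ P) := by
    constructor
    intro x
    obtain ⟨f, rfl⟩ := Ideal.Quotient.mk_surjective x
    induction f using MvPolynomial.induction_on with
    | C a => exact isIntegral_algebraMap (R := k) (A := MvPolynomial V k ⧸ P) (x := a)
    | add f g hf hg => rw [map_add]; exact hf.add hg
    | mul_X f v hf => rw [map_mul]; exact hf.mul (hint v)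
  exact Ideal.Quotient.maximal_of_isField _
    (isField_of_isIntegral_of_isField' (Field.toIsField k))

theorem isCohenMacaulayRing_of_regularOn [Fintype κ] {χ : V → κ} (hχ : ∀ F : Δ.Facet, Set.InjOn χ F.1)
    {α : V → Δ.Facet → ℕ}
    (hreg : ∀ q : κ → Polynomial k, (∀ c, (q c).Monic) →
      RegularOn (colourParameter χ q) Set.univ (MvPolynomial V k ⧸ thickenedIdeal k α)) :
    IsCohenMacaulayRing (MvPolynomial V k ⧸ thickenedIdeal k α) := by
  refine .of_forall_exists_isWeaklyRegular fun m hm => ?_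
  let π := Ideal.Quotient.mk (thickenedIdeal k α)
  have hπ : Function.Surjective π := Ideal.Quotient.mk_surjective
  have hm' : (m.comap π).IsMaximal := Ideal.comap_isMaximal_of_surjective π hπ
  choose q hq hqm using fun c : κ =>
    exists_monic_aeval_mem (m.comap π) (∑ v with χ v = c, X v)
  have hWR := hreg q hq Finset.univ.toList (Finset.nodup_toList _) (by simp)
  refine ⟨(Finset.univ.toList.map (colourParameter χ q)).map π, ?_, ?_, ?_⟩
  · simp only [List.mem_map, Finset.mem_toList]
    rintro _ ⟨_, ⟨c, -, rfl⟩, rfl⟩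
    exact hqm c
  · exact (isWeaklyRegular_map_algebraMap_iff _ _ _).2 hWR
  · intro p hp hmem
    have h1 : (p.comap π).IsMaximal := by
      refine isMaximal_of_colourParameter_mem hχ hq (α := α) ?_ fun c => ?_
      · intro x hx
        rw [Ideal.mem_comap, show π x = 0 from Ideal.Quotient.eq_zero_iff_mem.2 hx]
        exact zero_mem _
      · exact hmem _ (by simp)
    rw [← Ideal.map_comap_of_surjective π hπ p]
    refine (Ideal.map_eq_top_or_isMaximal_of_surjective π hπ h1).resolve_left ?_
    rw [Ideal.map_comap_of_surjective π hπ p]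
    exact hp.ne_top

end AbstractSimplicialComplex

/-! ### Adding the primary components one facet at a time. -/

theorem iInf_fin_induction {A : Type*} [CompleteLattice A] {m : ℕ} (Q : Fin m → A)
    (P : A → Prop) (h0 : P ⊤) (h1 : ∀ i, P (⨅ j < i, Q j) → P ((⨅ j < i, Q j) ⊓ Q i)) :
    P (⨅ i, Q i) := by
  have key : ∀ n ≤ m, P (⨅ (i : Fin m) (_ : i.val < n), Q i) := by
    intro n
    induction n with
    | zero => simp [h0]
    | succ n ih =>
      intro hn
      have hsucc : ⨅ (i : Fin m) (_ : i.val < n + 1), Q i =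
          (⨅ (i : Fin m) (_ : i < ⟨n, hn⟩), Q i) ⊓ Q ⟨n, hn⟩ := by
        refine le_antisymm (le_inf ?_ (iInf₂_le (⟨n, hn⟩ : Fin m) (Nat.lt_succ_self n))) ?_
        · exact le_iInf₂ fun i hi => iInf₂_le i (Nat.lt_succ_of_lt (Fin.lt_def.1 hi))
        · refine le_iInf₂ fun i hi => ?_
          rcases (Nat.lt_succ_iff_lt_or_eq).1 hi with h | h
          · exact inf_le_left.trans (iInf₂_le i h)
          · have : i = ⟨n, hn⟩ := Fin.ext h
            rw [this]
            exact inf_le_right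
      rw [hsucc]
      exact h1 _ (ih (Nat.le_of_succ_le hn))
  simpa using key m le_rfl

namespace AbstractSimplicialComplex

section Ideals

variable {k V κ : Type*} [Field k] [Fintype V] [DecidableEq V] [DecidableEq κ]
  {Δ : AbstractSimplicialComplex V} {α : V → Δ.Facet → ℕ}

omit [Fintype V] in
theorem primaryComponent_independentOf (F : Δ.Facet) {v : V} (hv : v ∈ F.1) :
    (primaryComponent k α F).IndependentOf v := by
  refine .span ?_
  rintro _ ⟨u, hu, rfl⟩
  exact Subalgebra.pow_mem _ (X_mem_withoutVar (by rintro rfl; exact hu hv)) _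

omit [Fintype V] [DecidableEq V] in
theorem X_pow_mem_primaryComponent {F : Δ.Facet} {v : V} (hv : v ∉ F.1) {n : ℕ}
    (hn : α v F ≤ n) : (X v : MvPolynomial V k) ^ n ∈ primaryComponent k α F :=
  (primaryComponent k α F).pow_mem_of_pow_mem (Ideal.subset_span ⟨v, hv, rfl⟩) hn

theorem regularOn_primaryComponent {χ : V → κ} {q : κ → Polynomial k} (hq : ∀ c, (q c).Monic)
    {F : Δ.Facet} (hF : ∀ c, ∃ v ∈ F.1, χ v = c) :
    RegularOn (colourParameter χ q) Set.univ (MvPolynomial V k ⧸ primaryComponent k α F) :=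
  .quotient_of_independentOf χ hq (U := F.1)
    (fun _ hv => primaryComponent_independentOf F hv) fun c _ => hF c

/-- By `hα` every generator of `Q_G` lies in `Q_F` or in `J`, so `J + Q_F = Q_G + Q_F`. The latter
omits the variables of `F ∩ G`, whose colours are all but possibly that of `w`, the one vertex that
`F` may have outside `G`. -/
theorem regularOn_inf_primaryComponent {χ : V → κ} {q : κ → Polynomial k}
    (hq : ∀ c, (q c).Monic) (hχ : ∀ (F : Δ.Facet) (c), ∃ v ∈ F.1, χ v = c) {F G : Δ.Facet}
    (hFG : ∃ w, ∀ v ∈ F.1, v ∉ G.1 → v = w) {J : Ideal (MvPolynomial V k)}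
    (hJG : J ≤ primaryComponent k α G)
    (hα : ∀ v, v ∉ G.1 → (v ∉ F.1 ∧ α v F ≤ α v G) ∨ (X v : MvPolynomial V k) ^ α v G ∈ J)
    (hJ : RegularOn (colourParameter χ q) Set.univ (MvPolynomial V k ⧸ J)) :
    RegularOn (colourParameter χ q) Set.univ
      (MvPolynomial V k ⧸ (J ⊓ primaryComponent k α F)) := by
  obtain ⟨w, hw⟩ := hFG
  refine RegularOn.quotient_inf (c := χ w) hJ (regularOn_primaryComponent hq (hχ F)) ?_
  have hsup : J ⊔ primaryComponent k α F = primaryComponent k α G ⊔ primaryComponent k α F := by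
    refine le_antisymm (sup_le_sup_right hJG _) (sup_le (Ideal.span_le.2 ?_) le_sup_right)
    rintro _ ⟨v, hv, rfl⟩
    rcases hα v hv with ⟨hvF, hle⟩ | h
    · exact Ideal.mem_sup_right (X_pow_mem_primaryComponent hvF hle)
    · exact Ideal.mem_sup_left h
  rw [hsup]
  refine .quotient_of_independentOf χ hq (U := F.1 ∩ G.1) (fun v hv => ?_) fun c hc => ?_
  · exact (primaryComponent_independentOf G hv.2).sup (primaryComponent_independentOf F hv.1)
  · obtain ⟨v, hv, rfl⟩ := hχ F c
    refine ⟨v, ⟨hv, ?_⟩, rfl⟩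
    by_contra hvG
    exact hc.2 (by rw [hw v hv hvG]; rfl)

theorem regularOn_thickenedIdeal {χ : V → κ} {q : κ → Polynomial k}
    (hq : ∀ c, (q c).Monic) (hχ : ∀ (F : Δ.Facet) (c), ∃ v ∈ F.1, χ v = c)
    {m : ℕ} (e : Fin m ≃ Δ.Facet) (b : Fin m → Δ.Facet)
    (hb : ∀ i : Fin m, 0 < i.val → ∃ j < i, e j = b i)
    (hw : ∀ i : Fin m, 0 < i.val → ∃ w, ∀ v ∈ (e i).1, v ∉ (b i).1 → v = w)
    (hα : ∀ i : Fin m, 0 < i.val → ∀ v, v ∉ (b i).1 → (v ∉ (e i).1 ∧ α v (e i) ≤ α v (b i)) ∨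
      ∀ j < i, v ∉ (e j).1 ∧ α v (e j) ≤ α v (b i)) :
    RegularOn (colourParameter χ q) Set.univ (MvPolynomial V k ⧸ thickenedIdeal k α) := by
  rw [thickenedIdeal, ← e.iInf_comp (g := primaryComponent k α)]
  refine iInf_fin_induction (fun i => primaryComponent k α (e i))
    (fun J => RegularOn (colourParameter χ q) Set.univ (MvPolynomial V k ⧸ J)) ?_ fun i h => ?_
  -- The empty intersection gives the zero module, on which every sequence is weakly regular.
  · have := Ideal.Quotient.subsingleton_iff.2 (rfl : (⊤ : Ideal (MvPolynomial V k)) = ⊤)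
    exact .of_subsingleton
  · rcases Nat.eq_zero_or_pos i.val with h0 | hpos
    · have : ⨅ j < i, primaryComponent k α (e j) = ⊤ :=
        iInf₂_eq_top.2 fun j hj => absurd (Fin.lt_def.1 hj) (by omega)
      rw [this, top_inf_eq]
      exact regularOn_primaryComponent hq (hχ _)
    · refine regularOn_inf_primaryComponent hq hχ (G := b i) (hw _ hpos) ?_ (fun v hv => ?_) h
      · obtain ⟨j, hj, hjb⟩ := hb i hpos
        rw [← hjb]
        exact iInf₂_le j hj
      · refine (hα i hpos v hv).imp_right fun h => ?_
        simp only [Submodule.mem_iInf]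
        exact fun j hj => X_pow_mem_primaryComponent (h j hj).1 (h j hj).2

end Ideals

/-! ### Paths in relation trees and the inequalities they force. -/

section Graphs

variable {V : Type*} {Δ : AbstractSimplicialComplex V} {T : SimpleGraph Δ.Facet} {v : V}

/-- The image of `p` under merging: steps between two facets containing `v` collapse. Both kinds of
starting point are treated together because the induction passes from one to the other. -/
theorem exists_walk_vertexGraph {K u : Δ.Facet} (p : T.Walk K u) (hu : v ∉ u.1) :
    (v ∈ K.1 → ∃ q : (vertexGraph T v).Walk none (some ⟨u, hu⟩),
      ∀ H, some H ∈ q.support → H.1 ∈ p.support) ∧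
    (∀ hK : v ∉ K.1, ∃ q : (vertexGraph T v).Walk (some ⟨K, hK⟩) (some ⟨u, hu⟩),
      ∀ H, some H ∈ q.support → H.1 ∈ p.support) := by
  induction p with
  | nil => exact ⟨fun h => absurd h hu, fun hK => ⟨.nil, by simp⟩⟩
  | @cons K K' u h p ih =>
    obtain ⟨ih1, ih2⟩ := ih hu
    refine ⟨fun hK => ?_, fun hK => ?_⟩
    · by_cases hK' : v ∈ K'.1
      · obtain ⟨q, hq⟩ := ih1 hK'
        exact ⟨q, fun H hH => List.mem_cons_of_mem _ (hq H hH)⟩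
      · obtain ⟨q, hq⟩ := ih2 hK'
        have hadj : (vertexGraph T v).Adj none (some ⟨K', hK'⟩) := ⟨K, hK, h⟩
        refine ⟨.cons hadj q, fun H hH => List.mem_cons_of_mem _ (hq H ?_)⟩
        simpa using hH
    · by_cases hK' : v ∈ K'.1
      · obtain ⟨q, hq⟩ := ih1 hK'
        have hadj : (vertexGraph T v).Adj (some ⟨K, hK⟩) none := ⟨K', hK', h.symm⟩
        refine ⟨.cons hadj q, fun H hH => ?_⟩
        rw [SimpleGraph.Walk.support_cons, List.mem_cons] at hH ⊢
        refine hH.imp (fun h => ?_) (hq H)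
        rw [Option.some.inj h]
      · obtain ⟨q, hq⟩ := ih2 hK'
        have hadj : (vertexGraph T v).Adj (some ⟨K, hK⟩) (some ⟨K', hK'⟩) := h
        refine ⟨.cons hadj q, fun H hH => ?_⟩
        rw [SimpleGraph.Walk.support_cons, List.mem_cons] at hH ⊢
        refine hH.imp (fun h => ?_) (hq H)
        rw [Option.some.inj h]

theorem isDirectedEdge_of_walk [DecidableEq V] {K u w : Δ.Facet} (p : T.Walk K u)
    (hK : v ∈ K.1) (hu : v ∉ u.1) (hw : v ∉ w.1) (h : T.Adj u w) (hwp : w ∉ p.support) :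
    IsDirectedEdge (vertexGraph T v) none (some ⟨u, hu⟩) (some ⟨w, hw⟩) := by
  obtain ⟨q, hq⟩ := (exists_walk_vertexGraph p hu).1 hK
  have hadj : (vertexGraph T v).Adj (some ⟨u, hu⟩) (some ⟨w, hw⟩) := h
  refine ⟨q.bypass, hadj, q.bypass_isPath.concat (fun hmem => ?_) hadj⟩
  exact hwp (hq _ (q.support_bypass_subset_support hmem))

/-- The walk `p` from a facet containing `v` makes every edge of `r` directed away from the merged
vertex, so the exponents decrease along `r`. -/
theorem le_of_path [DecidableEq V] {β : V → Δ.Facet → ℕ}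
    (hβ : ∀ F G : {F : Δ.Facet // v ∉ F.1},
      IsDirectedEdge (vertexGraph T v) none (some F) (some G) → β v G.1 ≤ β v F.1)
    {K u x : Δ.Facet} (hK : v ∈ K.1) (p : T.Walk K u) (r : T.Walk u x) (hr : r.IsPath)
    (hv : ∀ H ∈ r.support, v ∉ H.1) (hpr : ∀ H ∈ r.support.tail, H ∉ p.support) :
    β v x ≤ β v u := by
  induction r with
  | nil => exact le_rfl
  | @cons u u' x h r ih =>
    rw [SimpleGraph.Walk.cons_isPath_iff] at hr
    simp only [SimpleGraph.Walk.support_cons, List.tail_cons] at hv hpr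
    have hu : v ∉ u.1 := hv u (by simp)
    have hu' : v ∉ u'.1 := hv u' (by simp)
    refine (ih (p.concat h) hr.1 (fun H hH => hv H (List.mem_cons_of_mem _ hH)) ?_).trans
      (hβ ⟨u, hu⟩ ⟨u', hu'⟩ (isDirectedEdge_of_walk p hK hu hu' h (hpr u' (by simp))))
    intro H hH
    have hH' : H ∈ r.support := List.mem_of_mem_tail hH
    rw [SimpleGraph.Walk.support_concat, List.mem_append, List.mem_singleton, not_or]
    refine ⟨hpr H hH', ?_⟩
    rintro rfl
    have := hr.1.support_nodup
    rw [← SimpleGraph.Walk.cons_tail_support, List.nodup_cons] at this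
    exact this.1 hH

variable {m : ℕ} {e : Fin m ≃ Δ.Facet} {b : Fin m → Δ.Facet}

theorem exists_walk_to_first (hT : ∀ i : Fin m, 0 < i.val → T.Adj (e i) (b i))
    (hb : ∀ i : Fin m, 0 < i.val → ∃ j < i, e j = b i) (hm : 0 < m) (i : Fin m) :
    ∃ p : T.Walk (e i) (e ⟨0, hm⟩), ∀ H ∈ p.support, e.symm H ≤ i := by
  induction i using WellFoundedLT.induction with
  | ind i ih =>
    rcases Nat.eq_zero_or_pos i.val with h0 | hpos
    · obtain rfl : i = ⟨0, hm⟩ := Fin.ext h0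
      exact ⟨.nil, by simp⟩
    · obtain ⟨j, hj, hjb⟩ := hb i hpos
      obtain ⟨p, hp⟩ := ih j hj
      have hadj : T.Adj (e i) (e j) := hjb ▸ hT i hpos
      refine ⟨.cons hadj p, fun H hH => ?_⟩
      rw [SimpleGraph.Walk.support_cons, List.mem_cons] at hH
      rcases hH with rfl | hH
      · simp
      · exact (hp H hH).trans hj.le

theorem exists_path_from_branch [DecidableEq V]
    (hT : ∀ i : Fin m, 0 < i.val → T.Adj (e i) (b i))
    (hb : ∀ i : Fin m, 0 < i.val → ∃ j < i, e j = b i) {i j : Fin m} (hj : 0 < j.val)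
    (hij : i < j) :
    ∃ p : T.Walk (b j) (e i), p.IsPath ∧ ∀ H ∈ p.support, e.symm H < j := by
  have hm : 0 < m := hj.trans j.2
  obtain ⟨l, hl, hlb⟩ := hb j hj
  rw [← hlb]
  obtain ⟨p, hp⟩ := exists_walk_to_first hT hb hm l
  obtain ⟨r, hr⟩ := exists_walk_to_first hT hb hm i
  refine ⟨(p.append r.reverse).bypass, SimpleGraph.Walk.bypass_isPath _, fun H hH => ?_⟩
  have := SimpleGraph.Walk.support_bypass_subset_support _ hH
  rw [SimpleGraph.Walk.mem_support_append_iff, SimpleGraph.Walk.support_reverse,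
    List.mem_reverse] at this
  rcases this with h | h
  · exact (hp H h).trans_lt hl
  · exact (hr H h).trans_lt hij

/-- Passing repeatedly from a facet to its branch lowers the index, until the walk either hits `e j`
or drops below `j`; in the latter case it can go on to `b j` among facets of index less than `j`. -/
theorem exists_walk_or_exists_walk (hT : ∀ i : Fin m, 0 < i.val → T.Adj (e i) (b i))
    (hb : ∀ i : Fin m, 0 < i.val → ∃ j < i, e j = b i) {j : Fin m} (hj : 0 < j.val) (l : Fin m) :
    (∃ p : T.Walk (e l) (e j), ∀ H ∈ p.support, j ≤ e.symm H) ∨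
      ∃ p : T.Walk (e l) (b j), e j ∉ p.support := by
  classical
  induction l using WellFoundedLT.induction with
  | ind l ih =>
    rcases lt_trichotomy l j with hlj | rfl | hjl
    · obtain ⟨p, -, hp⟩ := exists_path_from_branch hT hb hj hlj
      refine .inr ⟨p.reverse, fun h => ?_⟩
      rw [SimpleGraph.Walk.support_reverse, List.mem_reverse] at h
      simpa using hp _ h
    · exact .inl ⟨.nil, by simp⟩
    · have hl : 0 < l.val := hj.trans hjl
      obtain ⟨i, hi, hib⟩ := hb l hl
      have hadj : T.Adj (e l) (e i) := hib ▸ hT l hl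
      refine (ih i hi).imp ?_ ?_
      · rintro ⟨p, hp⟩
        refine ⟨.cons hadj p, fun H hH => ?_⟩
        rw [SimpleGraph.Walk.support_cons, List.mem_cons] at hH
        rcases hH with rfl | hH
        · simpa using hjl.le
        · exact hp H hH
      · rintro ⟨p, hp⟩
        refine ⟨.cons hadj p, fun hH => ?_⟩
        rw [SimpleGraph.Walk.support_cons, List.mem_cons] at hH
        rcases hH with h | h
        · exact hjl.ne (e.injective h)
        · exact hp h

theorem exists_facet_mem [Finite V] (v : V) : ∃ F : Δ.Facet, v ∈ F.1 := by
  obtain ⟨F, hF, hmax⟩ := Set.Finite.exists_le_maximal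
    (Set.toFinite {s : Finset V | s ∈ Δ}) (a := {v}) (Δ.singleton_mem v)
  exact ⟨⟨F, hmax⟩, hF (by simp)⟩

/-- Consider the two sides of the tree edge between `e i` and `b i`. If a facet containing `v` is
reached on the side of `b i`, the edge is directed towards `e i`, which is the first alternative.
Otherwise the edge is directed towards `b i` and exponents decrease from there to all earlier
facets, which is the second. -/
theorem exponent_dichotomy [Finite V] [DecidableEq V] {β : V → Δ.Facet → ℕ}
    (hβ : ∀ (v : V) (F G : {F : Δ.Facet // v ∉ F.1}),
      IsDirectedEdge (vertexGraph T v) none (some F) (some G) → β v G.1 ≤ β v F.1)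
    (hT : ∀ i : Fin m, 0 < i.val → T.Adj (e i) (b i))
    (hbr : ∀ i : Fin m, 0 < i.val → IsBranch (initialFacets e i) (e i) (b i))
    {i : Fin m} (hi : 0 < i.val) (v : V) (hv : v ∉ (b i).1) :
    (v ∉ (e i).1 ∧ β v (e i) ≤ β v (b i)) ∨
      ∀ j < i, v ∉ (e j).1 ∧ β v (e j) ≤ β v (b i) := by
  have hb : ∀ i : Fin m, 0 < i.val → ∃ j < i, e j = b i := by
    intro i hi
    obtain ⟨⟨j, hj, hjb⟩, hne, -⟩ := hbr i hi
    refine ⟨j, lt_of_le_of_ne hj ?_, hjb⟩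
    rintro rfl
    exact hne hjb.symm
  have near : ∀ K : Δ.Facet, v ∈ K.1 → v ∉ (e i).1 → (p : T.Walk K (b i)) → e i ∉ p.support →
      β v (e i) ≤ β v (b i) := fun K hK hvi p hp =>
    hβ v ⟨b i, hv⟩ ⟨e i, hvi⟩ (isDirectedEdge_of_walk p hK hv hvi (hT i hi).symm hp)
  by_cases hearlier : ∃ j < i, v ∈ (e j).1
  · obtain ⟨j, hj, hvj⟩ := hearlier
    have hvi : v ∉ (e i).1 := fun hvi => hv (Finset.mem_inter.1
      ((hbr i hi).2.2 (e j) ⟨j, hj.le, rfl⟩ (fun h => hj.ne (e.injective h))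
        (Finset.mem_inter.2 ⟨hvj, hvi⟩))).1
    obtain ⟨p, -, hp⟩ := exists_path_from_branch hT hb hi hj
    refine .inl ⟨hvi, near _ hvj hvi p.reverse fun h => ?_⟩
    rw [SimpleGraph.Walk.support_reverse, List.mem_reverse] at h
    simpa using hp _ h
  · push Not at hearlier
    have far : ∀ K : Δ.Facet, v ∈ K.1 → (p : T.Walk K (e i)) →
        (∀ H ∈ p.support, i ≤ e.symm H) → ∀ j < i, v ∉ (e j).1 ∧ β v (e j) ≤ β v (b i) := by
      intro K hK p hp j hj
      refine ⟨hearlier j hj, ?_⟩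
      obtain ⟨r, hr, hri⟩ := exists_path_from_branch hT hb hi hj
      refine le_of_path (hβ v) hK (p.concat (hT i hi)) r hr (fun H hH => ?_) fun H hH => ?_
      · simpa using hearlier _ (hri H hH)
      · rw [SimpleGraph.Walk.support_concat, List.mem_append, List.mem_singleton, not_or]
        refine ⟨fun h => (hp H h).not_gt (hri H (List.mem_of_mem_tail hH)), ?_⟩
        rintro rfl
        have := hr.support_nodup
        rw [← SimpleGraph.Walk.cons_tail_support, List.nodup_cons] at this
        exact this.1 hH
    by_cases hvi : v ∈ (e i).1
    · exact .inr (far _ hvi .nil (by simp))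
    · obtain ⟨K, hK⟩ := exists_facet_mem (Δ := Δ) v
      obtain ⟨l, rfl⟩ := e.surjective K
      rcases exists_walk_or_exists_walk hT hb hi l with ⟨p, hp⟩ | ⟨p, hp⟩
      · exact .inr (far _ hK p hp)
      · exact .inl ⟨hvi, near _ hK hvi p hp⟩

end Graphs

end AbstractSimplicialComplex

/-! ### Strongly connected quasi-forests: branches of codimension one and colourings. -/

namespace AbstractSimplicialComplex

variable {V : Type*} [Fintype V] {Δ : AbstractSimplicialComplex V}

omit [Fintype V] in
theorem facet_eq_of_subset {F G : Δ.Facet} (h : F.1 ⊆ G.1) : F = G :=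
  Subtype.ext (Maximal.eq_of_le (P := fun s => s ∈ Δ) F.2 G.2.prop h)

theorem card_le_dimSucc {s : Finset V} (hs : s ∈ Δ) : s.card ≤ Δ.dimSucc :=
  le_csSup (Set.toFinite _).bddAbove ⟨s, hs, rfl⟩

theorem exists_facet_card_eq [Nonempty Δ.Facet] : ∃ F : Δ.Facet, F.1.card = Δ.dimSucc := by
  obtain ⟨G⟩ := ‹Nonempty Δ.Facet›
  obtain ⟨s, hs, hcard⟩ := Nat.sSup_mem (s := Finset.card '' {s : Finset V | s ∈ Δ})
    ⟨_, G.1, G.2.prop, rfl⟩ (Set.toFinite _).bddAbove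
  obtain ⟨F, hF, hmax⟩ := Set.Finite.exists_le_maximal
    (Set.toFinite {s : Finset V | s ∈ Δ}) (a := s) hs
  exact ⟨⟨F, hmax⟩, (card_le_dimSucc hmax.prop).antisymm
    (hcard.symm.le.trans (Finset.card_le_card hF))⟩

variable [DecidableEq V]

omit [Fintype V] in
theorem card_inter_lt {F G : Δ.Facet} (h : F ≠ G) : (F.1 ∩ G.1).card < F.1.card := by
  refine Finset.card_lt_card (Finset.inter_subset_left.ssubset_of_ne fun heq => h ?_)
  have hFG : F.1 ⊆ G.1 := Finset.inter_eq_left.1 heq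
  exact facet_eq_of_subset hFG

theorem facetGraph_adj_of_le_card {F G : Δ.Facet} (h : F ≠ G)
    (hle : Δ.dimSucc ≤ (F.1 ∩ G.1).card + 1) : Δ.facetGraph.Adj F G :=
  ⟨h, le_antisymm ((card_inter_lt h).trans_le (card_le_dimSucc F.2.prop)) hle⟩

theorem StronglyConnected.card_facet (h : Δ.StronglyConnected) (F : Δ.Facet) :
    F.1.card = Δ.dimSucc := by
  have : Nonempty Δ.Facet := ⟨F⟩
  obtain ⟨G, hG⟩ := exists_facet_card_eq (Δ := Δ)
  obtain ⟨p⟩ := h F G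
  cases p with
  | nil => exact hG
  | cons hadj _ =>
    exact (card_le_dimSucc F.2.prop).antisymm (hadj.2 ▸ card_inter_lt hadj.1)

theorem exists_forall_mem_notMem_eq {F G : Δ.Facet} (h : Δ.facetGraph.Adj F G) :
    ∃ w, ∀ v ∈ F.1, v ∉ G.1 → v = w := by
  have hc : (F.1 \ G.1).card ≤ 1 := by
    have h1 := Finset.card_inter_add_card_sdiff F.1 G.1
    have h2 := card_le_dimSucc F.2.prop
    have h3 := h.2
    omega
  obtain ⟨u, hu⟩ : (F.1 \ G.1).Nonempty := by
    rw [Finset.sdiff_nonempty]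
    exact fun hFG => h.1 (facet_eq_of_subset hFG)
  exact ⟨u, fun v hv hvG => Finset.card_le_one.1 hc v (Finset.mem_sdiff.2 ⟨hv, hvG⟩) u hu⟩

variable {m : ℕ} {e : Fin m ≃ Δ.Facet} {b : Fin m → Δ.Facet}

/-- Adjacency in the facet graph between facets among the first `t`. -/
def InitialAdj (e : Fin m ≃ Δ.Facet) (t : ℕ) (F G : Δ.Facet) : Prop :=
  (e.symm F).val < t ∧ (e.symm G).val < t ∧ Δ.facetGraph.Adj F G

/-- Since `H ∩ e i ⊆ b i`, both `e i ∩ b i` and `H ∩ b i` contain the `d - 1` vertices of `H ∩ e i`.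
-/
theorem IsBranch.facetGraph_adj {i : Fin m}
    (hbr : IsBranch (initialFacets e i) (e i) (b i)) {H : Δ.Facet} (hH : (e.symm H).val ≤ i.val)
    (hadj : Δ.facetGraph.Adj H (e i)) :
    Δ.facetGraph.Adj (e i) (b i) ∧ (H = b i ∨ Δ.facetGraph.Adj H (b i)) := by
  have hsub := hbr.2.2 H ⟨e.symm H, hH, by simp⟩ hadj.1
  have hcard := hadj.2.symm.le
  refine ⟨facetGraph_adj_of_le_card hbr.2.1.symm ?_, ?_⟩
  · rw [Finset.inter_comm]
    have := Finset.card_le_card hsub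
    omega
  · refine or_iff_not_imp_left.2 fun hne => facetGraph_adj_of_le_card hne ?_
    have := Finset.card_le_card (show H.1 ∩ (e i).1 ⊆ H.1 ∩ (b i).1 from fun x hx =>
      Finset.mem_inter.2 ⟨(Finset.mem_inter.1 hx).1, (Finset.mem_inter.1 (hsub hx)).1⟩)
    omega

omit [Fintype V] in
theorem IsBranch.exists_lt {i : Fin m} (hbr : IsBranch (initialFacets e i) (e i) (b i)) :
    ∃ j < i, e j = b i := by
  obtain ⟨⟨j, hj, hjb⟩, hne, -⟩ := hbr
  refine ⟨j, lt_of_le_of_ne hj ?_, hjb⟩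
  rintro rfl
  exact hne hjb.symm

/-- Strong connectedness survives removal of the last facet: replacing that facet by its branch in a
chain leaves consecutive members adjacent or equal. Hence the downward induction on `t`. -/
theorem StronglyConnected.reflTransGen_initialAdj (h : Δ.StronglyConnected)
    (hbr : ∀ i : Fin m, 0 < i.val → IsBranch (initialFacets e i) (e i) (b i))
    {t : ℕ} (ht : t ≤ m) (ht0 : 0 < t) : ∀ F G : Δ.Facet, (e.symm F).val < t →
      (e.symm G).val < t → Relation.ReflTransGen (InitialAdj e t) F G := by
  induction ht using Nat.decreasingInduction with
  | self =>
    intro F G _ _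
    obtain ⟨p⟩ := h F G
    induction p with
    | nil => exact .refl
    | cons hadj _ ih =>
      exact .head ⟨Fin.is_lt _, Fin.is_lt _, hadj⟩ (ih (Fin.is_lt _) (Fin.is_lt _))
  | of_succ t htm ih =>
    intro F G hF hG
    let i : Fin m := ⟨t, htm⟩
    obtain ⟨j, hj, hjb⟩ := (hbr i ht0).exists_lt
    have hbt : (e.symm (b i)).val < t := by
      rw [← hjb, Equiv.symm_apply_apply]
      exact hj
    let φ : Δ.Facet → Δ.Facet := fun F => if F = e i then b i else F
    have hφi : φ (e i) = b i := if_pos rfl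
    have hφ : ∀ {F}, F ≠ e i → φ F = F := fun hF => if_neg hF
    have hlt : ∀ {F}, F ≠ e i → (e.symm F).val < t + 1 → (e.symm F).val < t := by
      intro F hF hlt
      refine lt_of_le_of_ne (Nat.lt_succ_iff.1 hlt) fun heq => hF ?_
      rw [← (Fin.ext heq : e.symm F = i), Equiv.apply_symm_apply]
    have hne : ∀ {F}, (e.symm F).val < t → F ≠ e i := by
      rintro _ hlt rfl
      simp [i] at hlt
    have key : ∀ x y, InitialAdj e (t + 1) x y →
        Relation.ReflTransGen (InitialAdj e t) (φ x) (φ y) := by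
      rintro x y ⟨hx, hy, hxy⟩
      by_cases hxi : x = e i
      · subst hxi
        have hyi : y ≠ e i := hxy.1.symm
        rw [hφi, hφ hyi]
        rcases ((hbr i ht0).facetGraph_adj (hlt hyi hy).le hxy.symm).2 with rfl | hadj
        · exact .refl
        · exact .single ⟨hbt, hlt hyi hy, hadj.symm⟩
      · rw [hφ hxi]
        by_cases hyi : y = e i
        · subst hyi
          rw [hφi]
          rcases ((hbr i ht0).facetGraph_adj (hlt hxi hx).le hxy).2 with rfl | hadj
          · exact .refl
          · exact .single ⟨hlt hxi hx, hbt, hadj⟩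
        · rw [hφ hyi]
          exact .single ⟨hlt hxi hx, hlt hyi hy, hxy⟩
    have : Relation.ReflTransGen (InitialAdj e t) (φ F) (φ G) :=
      Relation.ReflTransGen.lift' φ key _ _
      (ih (Nat.succ_pos t) F G (Nat.lt_succ_of_lt hF) (Nat.lt_succ_of_lt hG))
    rwa [hφ (hne hF), hφ (hne hG)] at this

/-- In a strongly connected complex with a leaf order, each facet meets its branch in codimension
one. -/
theorem StronglyConnected.facetGraph_adj_branch (h : Δ.StronglyConnected)
    (hbr : ∀ i : Fin m, 0 < i.val → IsBranch (initialFacets e i) (e i) (b i))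
    {i : Fin m} (hi : 0 < i.val) : Δ.facetGraph.Adj (e i) (b i) := by
  obtain ⟨j, hj, hjb⟩ := (hbr i hi).exists_lt
  have hcon := h.reflTransGen_initialAdj hbr i.2 (Nat.succ_pos _) (e i) (b i)
    (by simp) (by simpa [← hjb] using Nat.lt_succ_of_lt (Fin.lt_def.1 hj))
  -- The first step of a chain from `e i` to `b i` gives an earlier facet `H` meeting `e i` in
  -- codimension one.
  rcases Relation.ReflTransGen.cases_head hcon with heq | ⟨H, ⟨-, hH, hadj⟩, -⟩
  · exact absurd heq.symm (hbr i hi).2.1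
  · exact ((hbr i hi).facetGraph_adj (Nat.lt_succ_iff.1 hH) hadj.symm).1

/-- A strongly connected quasi-forest of dimension `d - 1` has a proper vertex colouring with `d`
colours. -/
theorem StronglyConnected.exists_colouring (h : Δ.StronglyConnected)
    (hbr : ∀ i : Fin m, 0 < i.val → IsBranch (initialFacets e i) (e i) (b i)) :
    ∃ χ : V → Fin Δ.dimSucc, ∀ F : Δ.Facet, Set.InjOn χ F.1 := by
  have key : ∀ n ≤ m, ∃ χ : V → Fin Δ.dimSucc, ∀ i : Fin m, i.val < n →
      Set.InjOn χ (e i).1 := by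
    intro n
    induction n with
    | zero =>
      refine fun _ => ⟨fun v => ⟨0, ?_⟩, by simp⟩
      exact Nat.lt_of_lt_of_le (by simp) (card_le_dimSucc (Δ.singleton_mem v))
    | succ n ih =>
      intro hn
      obtain ⟨χ, hχ⟩ := ih (Nat.le_of_succ_le hn)
      have hsucc : ∀ i : Fin m, i.val < n + 1 → i.val < n ∨ i = ⟨n, hn⟩ := fun i hi =>
        (Nat.lt_succ_iff_lt_or_eq.1 hi).imp_right fun h => Fin.ext h
      rcases Nat.eq_zero_or_pos n with rfl | hpos
      · let φ := Finset.equivFinOfCardEq (h.card_facet (e ⟨0, hn⟩))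
        refine ⟨fun v => if hv : v ∈ (e ⟨0, hn⟩).1 then φ ⟨v, hv⟩ else χ v, fun i hi => ?_⟩
        obtain rfl := (hsucc i hi).resolve_left (Nat.not_lt_zero _)
        intro u hu v hv huv
        simp only [Finset.mem_coe] at hu hv
        simp only [hu, hv, dif_pos] at huv
        exact congrArg Subtype.val (φ.injective huv)
      · let i₀ : Fin m := ⟨n, hn⟩
        have hadj := h.facetGraph_adj_branch hbr (i := i₀) hpos
        obtain ⟨w, hw⟩ := exists_forall_mem_notMem_eq hadj
        obtain ⟨j₀, hj₀, hjb⟩ := (hbr i₀ hpos).exists_lt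
        obtain ⟨w', hw', hw'b⟩ : ∃ w' ∈ (e i₀).1, w' ∉ (b i₀).1 := by
          by_contra! hsub
          exact hadj.1 (facet_eq_of_subset hsub)
        obtain rfl := hw w' hw' hw'b
        obtain ⟨u, hub, hue⟩ : ∃ u ∈ (b i₀).1, u ∉ (e i₀).1 := by
          by_contra! hsub
          exact hadj.1 (facet_eq_of_subset hsub).symm
        have hχb : Set.InjOn χ (b i₀).1 := hjb ▸ hχ j₀ hj₀
        have hnew : ∀ x ∈ (e i₀).1, x ≠ w' → χ u ≠ χ x := by
          intro x hx hxw heq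
          have hxb : x ∈ (b i₀).1 := by
            by_contra hxb
            exact hxw (hw x hx hxb)
          exact hue (hχb hub hxb heq ▸ hx)
        -- The only new vertex `w'` takes the colour of `u`, a vertex of the branch that the new
        -- facet lacks. By the branch property `w'` lies in no earlier facet, so those keep their
        -- colours.
        refine ⟨Function.update χ w' (χ u), fun i hi x hx y hy hxy => ?_⟩
        rcases hsucc i hi with hlt | rfl
        · have hwi : ∀ z ∈ (e i).1, z ≠ w' := by
            rintro z hz rfl
            exact hw'b (Finset.mem_inter.1 ((hbr i₀ hpos).2.2 (e i) ⟨i, hlt.le, rfl⟩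
              (fun heq => hlt.ne (congrArg Fin.val (e.injective heq)))
              (Finset.mem_inter.2 ⟨hz, hw'⟩))).1
          rw [Function.update_of_ne (hwi x hx), Function.update_of_ne (hwi y hy)] at hxy
          exact hχ i hlt hx hy hxy
        · by_cases hxw : x = w' <;> by_cases hyw : y = w'
          · rw [hxw, hyw]
          · rw [hxw, Function.update_self, Function.update_of_ne hyw] at hxy
            exact absurd hxy (hnew y hy hyw)
          · rw [hyw, Function.update_self, Function.update_of_ne hxw] at hxy
            exact absurd hxy.symm (hnew x hx hxw)
          · rw [Function.update_of_ne hxw, Function.update_of_ne hyw] at hxy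
            refine hχb ?_ ?_ hxy
            · by_contra hxb
              exact hxw (hw x hx hxb)
            · by_contra hyb
              exact hyw (hw y hy hyb)
  obtain ⟨χ, hχ⟩ := key m le_rfl
  refine ⟨χ, fun F => ?_⟩
  have := hχ (e.symm F) (Fin.is_lt _)
  rwa [Equiv.apply_symm_apply] at this

theorem Satisfying.isCohenMacaulayRing (k : Type*) [Field k] {α : V → Δ.Facet → ℕ}
    (hα : Satisfying α) (h : Δ.StronglyConnected) :
    IsCohenMacaulayRing (MvPolynomial V k ⧸ thickenedIdeal k α) := by
  obtain ⟨T, ⟨m, e, b, -, hbr, rfl⟩, hα⟩ := hα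
  obtain ⟨χ, hχ⟩ := h.exists_colouring hbr
  refine isCohenMacaulayRing_of_regularOn hχ fun q hq => ?_
  have hsurj : ∀ (F : Δ.Facet) (c), ∃ v ∈ F.1, χ v = c := by
    intro F c
    have : F.1.image χ = Finset.univ := Finset.eq_univ_of_card _ <| by
      rw [Finset.card_image_of_injOn (hχ F), h.card_facet, Fintype.card_fin]
    simpa using this.ge (Finset.mem_univ c)
  refine regularOn_thickenedIdeal hq hsurj e b (fun i hi => (hbr i hi).exists_lt)
    (fun i hi => exists_forall_mem_notMem_eq (h.facetGraph_adj_branch hbr hi)) fun i hi v hv => ?_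
  refine exponent_dichotomy hα (fun i hi => ?_) hbr hi v hv
  rw [SimpleGraph.fromEdgeSet_adj]
  exact ⟨⟨i, hi, rfl⟩, (hbr i hi).2.1.symm⟩

end AbstractSimplicialComplex

/-! ### The counterexample to the converse: three edges with a common vertex. -/

namespace AbstractSimplicialComplex

/-- The three edges of the star with centre `0`. -/
def starEdge (i : Fin 3) : Finset (Fin 4) := {0, i.succ}

/-- The one-dimensional complex on `0, 1, 2, 3` whose facets are the edges at `0`. -/
def star : AbstractSimplicialComplex (Fin 4) where
  faces := {s | s.Nonempty ∧ ∃ i, s ⊆ starEdge i}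
  isRelLowerSet_faces := fun _ hs => ⟨hs.1, fun _ hts ht => ⟨ht, hs.2.imp fun _ h => hts.trans h⟩⟩
  singleton_mem := fun v => ⟨Finset.singleton_nonempty v, by revert v; decide⟩

theorem mem_star {s : Finset (Fin 4)} : s ∈ star ↔ s.Nonempty ∧ ∃ i, s ⊆ starEdge i :=
  Iff.rfl

theorem starEdge_subset {i j : Fin 3} (h : starEdge i ⊆ starEdge j) : i = j := by
  revert i j; decide

theorem mem_facets_star {s : Finset (Fin 4)} : s ∈ star.facets ↔ ∃ i, s = starEdge i := by
  have hmem : ∀ i, starEdge i ∈ star := fun i => ⟨⟨0, by simp [starEdge]⟩, i, le_rfl⟩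
  constructor
  · intro hs
    obtain ⟨-, i, hi⟩ := mem_star.1 hs.prop
    exact ⟨i, Maximal.eq_of_le (P := fun s => s ∈ star) hs (hmem i) hi⟩
  · rintro ⟨i, rfl⟩
    refine ⟨hmem i, fun t ht hle => ?_⟩
    obtain ⟨-, j, hj⟩ := mem_star.1 ht
    obtain rfl := starEdge_subset (hle.trans hj)
    exact hj

/-- The enumeration of the facets of the star. -/
noncomputable def starFacet : Fin 3 ≃ star.Facet :=
  Equiv.ofBijective (fun i => ⟨starEdge i, mem_facets_star.2 ⟨i, rfl⟩⟩)
    ⟨fun _ _ h => starEdge_subset (congrArg Subtype.val h).le,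
      fun F => (mem_facets_star.1 F.2).imp fun _ h => Subtype.ext h.symm⟩

theorem starFacet_val (i : Fin 3) : (starFacet i).1 = starEdge i := rfl

theorem dimSucc_star : star.dimSucc = 2 := by
  refine le_antisymm (csSup_le ⟨_, _, (starFacet 0).2.prop, rfl⟩ ?_) ?_
  · rintro _ ⟨s, hs, rfl⟩
    obtain ⟨-, i, hi⟩ := mem_star.1 hs
    exact (Finset.card_le_card hi).trans (by clear hi; revert i; decide)
  · exact card_le_dimSucc (s := starEdge 0) (starFacet 0).2.prop

theorem stronglyConnected_star : star.StronglyConnected := by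
  intro F G
  by_cases h : F = G
  · rw [h]
  · refine SimpleGraph.Adj.reachable (facetGraph_adj_of_le_card h ?_)
    rw [dimSucc_star]
    have : 0 < (F.1 ∩ G.1).card := by
      refine Finset.card_pos.2 ⟨0, ?_⟩
      obtain ⟨i, hi⟩ := mem_facets_star.1 F.2
      obtain ⟨j, hj⟩ := mem_facets_star.1 G.2
      simp [hi, hj, starEdge]
    omega

theorem starEdge_inter {i j : Fin 3} (h : i ≠ j) : starEdge i ∩ starEdge j = {0} := by
  revert i j; decide

theorem facet_star_inter {F G : star.Facet} (h : F ≠ G) : F.1 ∩ G.1 = {0} := by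
  obtain ⟨i, rfl⟩ := starFacet.surjective F
  obtain ⟨j, rfl⟩ := starFacet.surjective G
  exact starEdge_inter fun hij => h (congrArg _ hij)

theorem isQuasiTree_star : star.IsQuasiTree := by
  refine ⟨⟨3, starFacet, fun i => ⟨⟨i, le_rfl, rfl⟩, ?_⟩⟩, ?_⟩
  · by_cases hi : i = 0
    · left
      subst hi
      ext F
      constructor
      · rintro ⟨j, hj, rfl⟩
        rw [Fin.le_zero_iff.1 hj]
        rfl
      · rintro rfl
        exact ⟨0, le_rfl, rfl⟩
    · right
      have hne : starFacet 0 ≠ starFacet i := fun h => hi (starFacet.injective h).symm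
      refine ⟨starFacet 0, ⟨0, Fin.zero_le _, rfl⟩, hne, fun H _ hH => ?_⟩
      rw [facet_star_inter hH, facet_star_inter hne]
  · have key : ∀ v, star.oneSkeleton.Reachable 0 v := by
      intro v
      induction v using Fin.cases with
      | zero => rfl
      | succ i =>
        exact SimpleGraph.Adj.reachable ⟨(Fin.succ_ne_zero i).symm, (starFacet i).2.prop⟩
    exact ⟨fun u v => (key u).symm.trans (key v)⟩

/-- Exponents on the star: `2` for the vertex `i` and the edge of the cyclic successor of `i`,
`1` otherwise. -/
def starExponent (v : Fin 4) (F : star.Facet) : ℕ :=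
  if ∃ i : Fin 3, v = i.succ ∧ (i + 1).succ ∈ F.1 then 2 else 1

theorem starExponent_pos (v : Fin 4) (F : star.Facet) : 0 < starExponent v F := by
  rw [starExponent]
  split_ifs <;> norm_num

theorem starExponent_eq (i j : Fin 3) :
    starExponent i.succ (starFacet j) = if j = i + 1 then 2 else 1 := by
  have : (∃ i' : Fin 3, i.succ = i'.succ ∧ (i' + 1).succ ∈ (starFacet j).1) ↔ j = i + 1 := by
    rw [starFacet_val]
    revert i j
    decide
  simp only [starExponent, this]

theorem isCohenMacaulayRing_star (k : Type*) [Field k] :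
    IsCohenMacaulayRing (MvPolynomial (Fin 4) k ⧸ thickenedIdeal k starExponent) := by
  let χ : Fin 4 → Fin 2 := fun v => if v = 0 then 0 else 1
  have hinj : ∀ i, Set.InjOn χ (starEdge i) := by
    intro i u hu v hv
    simp only [Finset.mem_coe] at hu hv
    revert i u v
    decide
  have hsurj : ∀ i c, ∃ v ∈ starEdge i, χ v = c := by decide
  refine isCohenMacaulayRing_of_regularOn (χ := χ) (fun F => ?_) fun q hq => ?_
  · obtain ⟨i, hi⟩ := mem_facets_star.1 F.2
    rw [hi]
    exact hinj i
  let Q (F : star.Facet) := primaryComponent k starExponent F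
  have hQ : ∀ F, RegularOn (colourParameter χ q) Set.univ (MvPolynomial (Fin 4) k ⧸ Q F) := by
    intro F
    refine regularOn_primaryComponent hq fun c => ?_
    obtain ⟨i, hi⟩ := mem_facets_star.1 F.2
    rw [hi]
    exact hsurj i c
  have hind : ∀ F, (Q F).IndependentOf 0 := by
    intro F
    refine primaryComponent_independentOf F ?_
    obtain ⟨i, hi⟩ := mem_facets_star.1 F.2
    simp [hi, starEdge]
  -- In dimension two the sums of components only need one regular parameter, that of colour `0`,
  -- and they all omit the variable of the centre.
  have hlow : ∀ J : Ideal (MvPolynomial (Fin 4) k), J.IndependentOf 0 →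
      RegularOn (colourParameter χ q) (Set.univ \ {1}) (MvPolynomial (Fin 4) k ⧸ J) := by
    intro J hJ
    refine .quotient_of_independentOf χ hq (U := {0}) (by rintro _ rfl; exact hJ) ?_
    rintro c ⟨-, hc⟩
    refine ⟨0, rfl, ?_⟩
    simp only [Set.mem_singleton_iff] at hc
    simp only [χ, if_pos]
    omega
  have h01 := RegularOn.quotient_inf (hQ (starFacet 0)) (hQ (starFacet 1))
    (hlow _ ((hind _).sup (hind _)))
  have h012 := RegularOn.quotient_inf h01 (hQ (starFacet 2))
    (hlow _ (((hind _).inf (hind _)).sup (hind _)))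
  have heq : thickenedIdeal k starExponent =
      Q (starFacet 0) ⊓ Q (starFacet 1) ⊓ Q (starFacet 2) := by
    rw [thickenedIdeal, ← starFacet.iInf_comp (g := primaryComponent k starExponent)]
    refine le_antisymm (le_inf (le_inf (iInf_le _ 0) (iInf_le _ 1)) (iInf_le _ 2)) ?_
    refine le_iInf fun i => ?_
    fin_cases i
    · exact inf_le_left.trans inf_le_left
    · exact inf_le_left.trans inf_le_right
    · exact inf_le_right
  rw [heq]
  exact h012

theorem not_satisfying_star : ¬ Satisfying starExponent := by
  rintro ⟨T, ⟨m, e, b, -, hbr, rfl⟩, hα⟩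
  have hm : m = 3 := by
    simpa using Fintype.card_congr (e.trans starFacet.symm)
  subst hm
  set T := SimpleGraph.fromEdgeSet {x | ∃ i : Fin 3, 0 < i.val ∧ x = s(e i, b i)}
  have hT : ∀ i : Fin 3, 0 < i.val → T.Adj (e i) (b i) := fun i hi => by
    rw [SimpleGraph.fromEdgeSet_adj]
    exact ⟨⟨i, hi, rfl⟩, (hbr i hi).2.1.symm⟩
  -- The tree is a path; let `c` be its middle vertex.
  obtain ⟨c, f, l, hcf, hcl, hfl, hadjf, hadjl⟩ : ∃ c f l : Fin 3, c ≠ f ∧ c ≠ l ∧ f ≠ l ∧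
      T.Adj (starFacet c) (starFacet f) ∧ T.Adj (starFacet c) (starFacet l) := by
    have h1 := hT 1 (by decide)
    have h2 := hT 2 (by decide)
    obtain ⟨j1, hj1, hb1⟩ := (hbr 1 (by decide)).exists_lt
    obtain ⟨j2, hj2, hb2⟩ := (hbr 2 (by decide)).exists_lt
    rw [← hb1] at h1
    rw [← hb2] at h2
    have hσ : ∀ i, e i = starFacet (starFacet.symm (e i)) := by simp
    have hne : ∀ i j, i ≠ j → starFacet.symm (e i) ≠ starFacet.symm (e j) := by simp
    rw [hσ, hσ j1] at h1
    rw [hσ, hσ j2] at h2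
    obtain rfl : j1 = 0 := by omega
    obtain rfl | rfl : j2 = 0 ∨ j2 = 1 := by omega
    · exact ⟨_, _, _, hne 0 1 (by decide), hne 0 2 (by decide), hne 1 2 (by decide),
        h1.symm, h2.symm⟩
    · exact ⟨_, _, _, hne 1 0 (by decide), hne 1 2 (by decide), hne 0 2 (by decide),
        h1, h2.symm⟩
  -- For the outer vertex of an end `f` of the path, the edge from `c` to the other end `l` is
  -- directed. Of the two ends, one is the cyclic successor of the other, so one of the resulting
  -- inequalities reads `2 ≤ 1`.
  have key : ∀ c f l : Fin 3, c ≠ f → c ≠ l → f ≠ l → T.Adj (starFacet c) (starFacet f) →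
      T.Adj (starFacet c) (starFacet l) →
      starExponent f.succ (starFacet l) ≤ starExponent f.succ (starFacet c) := by
    intro c f l hcf hcl hfl hadjf hadjl
    have hnot : ∀ i j : Fin 3, i ≠ j → j.succ ∉ (starFacet i).1 := by
      intro i j
      rw [starFacet_val]
      revert i j
      decide
    have hfm : f.succ ∈ (starFacet f).1 := by simp [starFacet_val, starEdge]
    refine hα f.succ ⟨starFacet c, hnot c f hcf⟩ ⟨starFacet l, hnot l f hfl.symm⟩
      (isDirectedEdge_of_walk (.cons hadjf.symm .nil) hfm _ _ hadjl ?_)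
    simp [hfl.symm, hcl.symm]
  have h1 := key c f l hcf hcl hfl hadjf hadjl
  have h2 := key c l f hcl hcf hfl.symm hadjl hadjf
  rw [starExponent_eq, starExponent_eq] at h1 h2
  clear key hadjf hadjl
  revert c f l
  decide

end AbstractSimplicialComplex

theorem theorem4 (k : Type*) [Field k] :
    (∀ (V : Type*) [Fintype V] [DecidableEq V] (Δ : AbstractSimplicialComplex V)
      (α : V → Δ.Facet → ℕ),
      Δ.StronglyConnected → Δ.IsQuasiForest →
      (∀ (v : V) (F : Δ.Facet), v ∉ F.1 → 0 < α v F) →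
      AbstractSimplicialComplex.Satisfying α →
      IsCohenMacaulayRing
        (MvPolynomial V k ⧸ AbstractSimplicialComplex.thickenedIdeal k α)) ∧
    (∃ (n : ℕ) (Δ : AbstractSimplicialComplex (Fin n)) (α : Fin n → Δ.Facet → ℕ),
      Δ.StronglyConnected ∧ Δ.IsQuasiTree ∧
      (∀ (v : Fin n) (F : Δ.Facet), v ∉ F.1 → 0 < α v F) ∧
      IsCohenMacaulayRing
        (MvPolynomial (Fin n) k ⧸ AbstractSimplicialComplex.thickenedIdeal k α) ∧
      ¬ AbstractSimplicialComplex.Satisfying α) :=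
  ⟨fun _ _ _ _ _ h _ _ hα => hα.isCohenMacaulayRing k h,
    4, .star, AbstractSimplicialComplex.starExponent,
    AbstractSimplicialComplex.stronglyConnected_star, AbstractSimplicialComplex.isQuasiTree_star,
    fun v F _ => AbstractSimplicialComplex.starExponent_pos v F,
    AbstractSimplicialComplex.isCohenMacaulayRing_star k,
    AbstractSimplicialComplex.not_satisfying_star⟩
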